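/- Let $G$ be a locally finite connected simple graph which satisfies one of the following: (a) $G$ is vertex-transitive and has exponential growth, i.e. there is $K>1$ with $|B(x,r)|\ge K^r$ for all vertices $x$ and all integers $r\ge 1$; (b) $G$ (transitive or not) has pinched exponential growth, i.e. there are $C,K>1$ with $C^{-1}K^r\le |B(x,r)|\le CK^r$ for all vertices $x$ and all integers $r\ge 0$. Here $B(x,r)$ is the ball of radius $r$ about $x$ in the graph distance. For a finite set $A$ of vertices let $\partial A$ be the set of vertices outside $A$ with a neighbour in $A$, and let $h_A(x)=e_A(x)/\sum_y e_A(y)$ be the harmonic measure from infinity, where $e_A(x)=\mathbf 1\{x\in A\}\,\deg(x)\,\Pr_x[X_t\notin A\text{ for all }t\ge 1]$ and $(X_t)$ is simple random walk on $G$. Let $o$ be a vertex and let $(A_t)_{t\ge 0}$ be diffusion limited aggregation (DLA) on $G$ started at $A_0=\{o\}$: given $A_0,\dots,A_t$, one has $A_{t+1}=A_t\cup\{a_{t+1}\}$, where $a_{t+1}$ is a random vertex of $\partial A_t$ that equals $x$ with conditional probability $h_{A_t\cup\partial A_t}(x)$. Put $\mathrm{rad}(A_t)=\max\{\mathrm{dist}(o,x):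 x\in A_t\}$. Then almost surely $$\limsup_{t\to\infty}\,(\log t)^{-4}\cdot \mathrm{rad}(A_t)<\infty .$$ -/

import Mathlib

open Filter MeasureTheory ProbabilityTheory

noncomputable section

namespace DLA

variable {V : Type*}

/-! ### Simple random walk on a locally finite graph -/

section Walk

variable (G : SimpleGraph V) [G.LocallyFinite]

/-- One step of simple random walk from `x`: a uniformly chosen neighbour of `x`.
(At an isolated vertex, which a connected graph with at least two vertices does not have,
the walk stays put.) -/
def stepPMF (x : V) : PMF V :=
  if h : (G.neighborFinset x).Nonempty then PMF.uniformOfFinset (G.neighborFinset x) h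
  else PMF.pure x

variable [MeasurableSpace V] [DiscreteMeasurableSpace V]

/-- The transition kernel of simple random walk. -/
def stepKernel : Kernel V V where
  toFun x := (stepPMF G x).toMeasure
  measurable' := Measurable.of_discrete

instance : IsMarkovKernel (stepKernel G) :=
  ⟨fun x => inferInstanceAs (IsProbabilityMeasure (stepPMF G x).toMeasure)⟩

/-- The transition from the history `X₀, …, Xₙ` to `Xₙ₊₁`: it depends on `Xₙ` only. -/
def historyKernel (n : ℕ) : Kernel (Finset.Iic n → V) V :=
  (stepKernel G).comap (fun p => p ⟨n, Finset.mem_Iic.2 le_rfl⟩) (measurable_pi_apply _)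

instance (n : ℕ) : IsMarkovKernel (historyKernel G n) := by
  unfold historyKernel; infer_instance

/-- The law `Pr_x`, on the space of trajectories `ℕ → V`, of simple random walk `(X_t)`
started at `X₀ = x`. -/
def walkLaw (x : V) : Measure (ℕ → V) :=
  Kernel.traj (X := fun _ : ℕ => V) (historyKernel G) 0 (fun _ => x)

/-- `Pr_x [T_A⁺ = ∞]`: the walk from `x` is never in `A` at a time `t ≥ 1`. -/
def escapeProb (A : Finset V) (x : V) : ℝ :=
  (walkLaw G x).real {X | ∀ t : ℕ, 1 ≤ t → X t ∉ A}

/-- The equilibrium measure `e_A(x) = 1_{x ∈ A} deg(x) Pr_x [T_A⁺ = ∞]`. -/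
def equilibriumMeasure [DecidableEq V] (A : Finset V) (x : V) : ℝ :=
  if x ∈ A then (G.degree x : ℝ) * escapeProb G A x else 0

/-- The capacity `cap(A) = ∑ₓ e_A(x)`. -/
def capacity [DecidableEq V] (A : Finset V) : ℝ :=
  ∑ x ∈ A, equilibriumMeasure G A x

/-- The harmonic measure from infinity, `h_A(x) = e_A(x) / cap(A)`. -/
def harmonicMeasure [DecidableEq V] (A : Finset V) (x : V) : ℝ :=
  equilibriumMeasure G A x / capacity G A

end Walk

/-! ### Diffusion limited aggregation -/

/-- The outer boundary `∂A`: the vertices outside `A` that have a neighbour in `A`. -/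
def outerBoundary [DecidableEq V] (G : SimpleGraph V) [G.LocallyFinite] (A : Finset V) :
    Finset V :=
  A.biUnion (fun y => G.neighborFinset y) \ A

/-- `rad(A) = max {dist(o, x) : x ∈ A}`. -/
def rad (G : SimpleGraph V) (o : V) (A : Finset V) : ℕ :=
  A.sup (fun x => G.dist o x)

/-- The process `(A_t)`, defined on the probability space `(Ω, P)`, is DLA on `G` started at
`A₀ = S`: each `A_{t+1}` is `A_t ∪ {a_{t+1}}` with `a_{t+1} ∈ ∂A_t`, and, given the history
`A₀ = B₀, …, A_t = B_t`, the vertex `a_{t+1}` equals `x ∈ ∂B_t` with conditional probability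
`h_{B_t ∪ ∂B_t}(x)`. -/
structure IsDLA [DecidableEq V] [MeasurableSpace V] [DiscreteMeasurableSpace V]
    (G : SimpleGraph V) [G.LocallyFinite] (S : Finset V)
    {Ω : Type*} [MeasurableSpace Ω] (P : Measure Ω) (A : ℕ → Ω → Finset V) : Prop where
  measurableSet_eq : ∀ (t : ℕ) (B : Finset V), MeasurableSet {ω | A t ω = B}
  init : ∀ᵐ ω ∂P, A 0 ω = S
  growth : ∀ᵐ ω ∂P, ∀ t : ℕ, ∃ x ∈ outerBoundary G (A t ω), A (t + 1) ω = insert x (A t ω)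
  transition : ∀ (t : ℕ) (B : ℕ → Finset V), ∀ x ∈ outerBoundary G (B t),
    P.real {ω | (∀ i ≤ t, A i ω = B i) ∧ A (t + 1) ω = insert x (B t)} =
      P.real {ω | ∀ i ≤ t, A i ω = B i} *
        harmonicMeasure G (B t ∪ outerBoundary G (B t)) x

/-! ### Transitivity and growth of graphs -/

/-- The automorphism group of `G` acts transitively on the vertices. -/
def IsTransitive (G : SimpleGraph V) : Prop :=
  ∀ x y : V, ∃ φ : G ≃g G, φ x = y

/-- The closed ball of radius `r` about `x` in the graph distance of a connected graph. -/
def ball (G : SimpleGraph V) (x : V) (r : ℕ) : Set V :=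
  {y | G.dist x y ≤ r}

/-- Exponential growth: `|B(x,r)| ≥ K ^ r` for some `K > 1`, all `x` and all `r ≥ 1`. -/
def HasExponentialGrowth (G : SimpleGraph V) : Prop :=
  ∃ K : ℝ, 1 < K ∧ ∀ (x : V) (r : ℕ), 1 ≤ r → K ^ r ≤ ((ball G x r).ncard : ℝ)

/-- Pinched exponential growth: `C⁻¹ K ^ r ≤ |B(x,r)| ≤ C K ^ r` for some `C, K > 1`,
all `x` and all `r`. -/
def HasPinchedExponentialGrowth (G : SimpleGraph V) : Prop :=
  ∃ C K : ℝ, 1 < C ∧ 1 < K ∧ ∀ (x : V) (r : ℕ),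
    C⁻¹ * K ^ r ≤ ((ball G x r).ncard : ℝ) ∧ ((ball G x r).ncard : ℝ) ≤ C * K ^ r

end DLA

end

/-!
The proof replaces heat kernel and Green function estimates by a Faber–Krahn inequality, and the
enumeration of ancestral lines of the aggregate by an exponential moment.

**Faber–Krahn inequality.** Let `E(f) = ∑ₓ ∑_{y ∼ x} (f x - f y)²`. Both growth hypotheses give
`‖f‖² ≤ C (1 + log |S|)² E(f)` for `f` supported on a finite set `S`
(`radialFaberKrahn`, `RadialFaberKrahn.exists_log`). Take `r` of order `log |S|` such that balls of
radius `r` have at least `2 |S|` vertices. From every `x ∈ S`, at least half of the geodesics to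
the vertices of the ball of radius `r` about `x` leave `S`; if these geodesics do not concentrate
on few vertices, Cauchy–Schwarz along them gives the inequality (`mul_normSq_le_of_pathFamily`).

* Under pinched growth, at most `C² K ^ r` geodesics are at a given vertex at a given time,
  whatever geodesics are chosen (`radialFaberKrahn_of_pinched`).
* On a transitive graph, choose geodesics from one vertex `o` and move them by all automorphisms.
  If `|Γ_x y| = |Γ_y x|` for all adjacent `x`, `y`, where `Γ_x` is the stabilizer of `x`, the
  translates are equidistributed (`radialFaberKrahn_of_unimodular`). To count only finitely many
  objects over each vertex, automorphisms are replaced by their restrictions to a ball.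
* Otherwise `α x y = (|Γ_y x| / |Γ_x y|) ^ (1/2)` satisfies `α x y * α y x = 1`, and by mass
  transport and strict Cauchy–Schwarz `∑_{y ∼ x} α x y` is a constant below the degree. Then
  `2 f(x) f(y) ≤ α x y f(x)² + α y x f(y)²` gives a spectral gap
  (`radialFaberKrahn_of_nonunimodular`).

**Capacity.** Cutting `f` at dyadic levels, the Faber–Krahn inequality implies
`E(f) ≥ c |A| / (1 + log |A|)²` for every finitely supported `f` that equals `1` on `A`
(`RadialFaberKrahn.exists_le_energy`). Apply this to the probability `f` of hitting `A` by time `n`: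
it is superharmonic off `A`, so summation by parts bounds `E(f)` by twice the sum over `x ∈ A` of
`deg x` times the probability of no return by time `n + 1`. As `n → ∞` this gives
`cap(A) ≥ c |A| / (1 + log |A|)²` (`exists_le_capacity`), hence
`h(x) ≤ C (1 + log t)² / t` for the harmonic measure of an aggregate of `t` vertices and its
boundary (`exists_harmonicMeasure_le`).

**Growth.** Let `Z(A) = ∑_{x ∈ A} 2 ^ dist(o, x) ≥ 2 ^ rad(A)`. When degrees are at most `D`, the
weight of `∂A` is at most `2 D Z(A)`, so one step of the aggregation multiplies the expectation of
`Z(A_t)` by at most `1 + 2 D max h`. Hence `E Z(A_T) ≤ exp (C (log T)³)`, and Markov's inequality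
and the Borel–Cantelli lemma show that `rad(A_T)` is almost surely at most a constant times
`(log T)³` for large `T` (`IsDLA.exists_ae_rad_le`), which is more than is needed.
-/

noncomputable section

namespace DLA

open scoped ENNReal Pointwise

/-! ### Dirichlet energy and path families -/

section Energy

variable {V : Type*} (G : SimpleGraph V) [G.LocallyFinite]

/-- The Dirichlet energy `∑ₓ ∑_{y ∼ x} (f x - f y)²`, in which every edge is counted in both
directions. -/
def energy (f : V → ℝ) : ℝ≥0∞ :=
  ∑' x, ∑ y ∈ G.neighborFinset x, ENNReal.ofReal ((f x - f y) ^ 2)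

/-- The squared `ℓ²`-norm with respect to counting measure. -/
def normSq (f : V → ℝ) : ℝ≥0∞ := ∑' x, ENNReal.ofReal (f x ^ 2)

variable {G}

theorem normSq_ne_top {f : V → ℝ} {S : Finset V} (hf : ∀ x ∉ S, f x = 0) : normSq f ≠ ∞ := by
  rw [normSq, tsum_eq_sum (s := S) (fun x hx => by simp [hf x hx])]
  exact ENNReal.sum_ne_top.2 fun x _ => ENNReal.ofReal_ne_top

theorem tsum_sum_neighborFinset_comm (g : V → V → ℝ≥0∞) :
    ∑' x, ∑ y ∈ G.neighborFinset x, g x y = ∑' x, ∑ y ∈ G.neighborFinset x, g y x := by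
  classical
  have key : ∀ h : V → V → ℝ≥0∞, ∀ x, ∑ y ∈ G.neighborFinset x, h x y =
      ∑' y, if G.Adj x y then h x y else 0 := by
    intro h x
    rw [tsum_eq_sum (s := G.neighborFinset x) (fun y hy => by simp_all)]
    exact Finset.sum_congr rfl fun y hy => by simp_all
  simp_rw [key]
  rw [ENNReal.tsum_comm]
  simp_rw [key (fun x y => g y x), G.adj_comm]

theorem energy_comp_le {f : V → ℝ} {φ : ℝ → ℝ} (hφ : ∀ a b, |φ a - φ b| ≤ |a - b|) :
    energy G (fun x => φ (f x)) ≤ energy G f :=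
  ENNReal.tsum_le_tsum fun _ => Finset.sum_le_sum fun _ _ =>
    ENNReal.ofReal_le_ofReal (sq_le_sq.2 (hφ _ _))

theorem tsum_comp_le_of_encard_fiber_le {T : Type*} (p : T → V) {M : ℝ≥0∞}
    (h : ∀ x, ({t | p t = x}.encard : ℝ≥0∞) ≤ M) (F : V → ℝ≥0∞) :
    ∑' t, F (p t) ≤ M * ∑' x, F x := by
  rw [← ENNReal.tsum_fiberwise _ p, ← ENNReal.tsum_mul_left]
  refine ENNReal.tsum_le_tsum fun x => ?_
  calc ∑' t : p ⁻¹' {x}, F (p t) = ∑' _ : p ⁻¹' {x}, F x :=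
        tsum_congr fun t => by rw [t.2]
    _ = ({t | p t = x}.encard : ℝ≥0∞) * F x := ENNReal.tsum_set_const _ _
    _ ≤ M * F x := by gcongr; exact h x

/-- Comparison of the `ℓ²`-norm with the Dirichlet energy through a family of paths of length `r`:
if every vertex of the support is the start of at least `M₀` paths that end off the support, while
at each time at most `M₁` paths are at a given vertex, then `M₀ ‖f‖² ≤ r² M₁ E(f)`. -/
theorem mul_normSq_le_of_pathFamily {T : Type*} (p : T → ℕ → V) (r : ℕ)
    (hstep : ∀ t, ∀ j < r, p t (j + 1) = p t j ∨ G.Adj (p t j) (p t (j + 1)))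
    {M₀ M₁ : ℝ≥0∞} (h₁ : ∀ j < r, ∀ x, ({t | p t j = x}.encard : ℝ≥0∞) ≤ M₁)
    {S : Finset V} {f : V → ℝ} (hf : ∀ x ∉ S, f x = 0)
    (h₀ : ∀ x ∈ S, M₀ ≤ ({t | p t 0 = x ∧ p t r ∉ S}.encard : ℝ≥0∞)) :
    M₀ * normSq f ≤ r ^ 2 * M₁ * energy G f := by
  set u : T → ℝ≥0∞ := fun t => ENNReal.ofReal ((f (p t 0) - f (p t r)) ^ 2) with hu
  have lower : M₀ * normSq f ≤ ∑' t, u t := by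
    rw [normSq, ← ENNReal.tsum_mul_left, ← ENNReal.tsum_fiberwise u (fun t => p t 0)]
    refine ENNReal.tsum_le_tsum fun x => ?_
    by_cases hx : x ∈ S
    · calc M₀ * ENNReal.ofReal (f x ^ 2)
          ≤ ({t | p t 0 = x ∧ p t r ∉ S}.encard : ℝ≥0∞) * ENNReal.ofReal (f x ^ 2) := by
            gcongr; exact h₀ x hx
        _ = ∑' _ : {t | p t 0 = x ∧ p t r ∉ S}, ENNReal.ofReal (f x ^ 2) :=
            (ENNReal.tsum_set_const _ _).symm
        _ = ∑' t : {t | p t 0 = x ∧ p t r ∉ S}, u t := by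
            refine tsum_congr fun t => ?_
            obtain ⟨h1, h2⟩ := t.2
            simp [hu, h1, hf _ h2]
        _ ≤ _ := ENNReal.tsum_mono_subtype u fun t ht => ht.1
    · simp [hf x hx]
  have upper : ∀ t, u t ≤ r * ∑ j ∈ Finset.range r,
      ∑ y ∈ G.neighborFinset (p t j), ENNReal.ofReal ((f (p t j) - f y) ^ 2) := by
    intro t
    have h1 : (f (p t 0) - f (p t r)) ^ 2 ≤
        r * ∑ j ∈ Finset.range r, (f (p t j) - f (p t (j + 1))) ^ 2 := by
      rw [← Finset.sum_range_sub' (fun j => f (p t j)) r]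
      simpa using sq_sum_le_card_mul_sum_sq (s := Finset.range r)
        (f := fun j => f (p t j) - f (p t (j + 1)))
    refine (ENNReal.ofReal_le_ofReal h1).trans ?_
    rw [ENNReal.ofReal_mul (by positivity), ENNReal.ofReal_natCast,
      ENNReal.ofReal_sum_of_nonneg fun _ _ => by positivity]
    gcongr with j hj
    rcases hstep t j (Finset.mem_range.1 hj) with h | h
    · simp [h]
    · exact Finset.single_le_sum (f := fun y => ENNReal.ofReal ((f (p t j) - f y) ^ 2))
        (fun _ _ => zero_le) (by simpa using h)
  calc M₀ * normSq f ≤ ∑' t, u t := lower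
    _ ≤ ∑' t, r * ∑ j ∈ Finset.range r,
          ∑ y ∈ G.neighborFinset (p t j), ENNReal.ofReal ((f (p t j) - f y) ^ 2) :=
        ENNReal.tsum_le_tsum upper
    _ = r * ∑ j ∈ Finset.range r, ∑' t,
          ∑ y ∈ G.neighborFinset (p t j), ENNReal.ofReal ((f (p t j) - f y) ^ 2) := by
        rw [ENNReal.tsum_mul_left, Summable.tsum_finsetSum fun _ _ => ENNReal.summable]
    _ ≤ r * ∑ j ∈ Finset.range r, M₁ * energy G f := by
        gcongr with j hj
        exact tsum_comp_le_of_encard_fiber_le (fun t => p t j) (h₁ j (Finset.mem_range.1 hj))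
          (fun x => ∑ y ∈ G.neighborFinset x, ENNReal.ofReal ((f x - f y) ^ 2))
    _ = r ^ 2 * M₁ * energy G f := by
        rw [Finset.sum_const, Finset.card_range, nsmul_eq_mul]; ring

end Energy

/-! ### Geodesics and balls -/

section Balls

variable {V : Type*} {G : SimpleGraph V}

/-- A geodesic from `x` to `y`, stopped at `y`. -/
theorem exists_geodesic (hconn : G.Connected) (x y : V) :
    ∃ p : ℕ → V, p 0 = x ∧ (∀ j, p (j + 1) = p j ∨ G.Adj (p j) (p (j + 1))) ∧
      (∀ j, G.dist x y ≤ j → p j = y) ∧ (∀ j, G.dist x (p j) ≤ j) ∧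
      ∀ j, G.dist (p j) y ≤ G.dist x y - j := by
  obtain ⟨w, hw⟩ := hconn.exists_walk_length_eq_dist x y
  refine ⟨w.getVert, w.getVert_zero, fun j => ?_, fun j hj => w.getVert_of_length_le (hw ▸ hj),
    fun j => ?_, fun j => ?_⟩
  · rcases lt_or_ge j w.length with h | h
    · exact Or.inr (w.adj_getVert_succ h)
    · exact Or.inl (by rw [w.getVert_of_length_le h, w.getVert_of_length_le (by omega)])
  · refine (SimpleGraph.dist_le (w.take j)).trans ?_
    simp
  · refine (SimpleGraph.dist_le (w.drop j)).trans ?_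
    simp [hw]

theorem exists_adj_dist_eq (hconn : G.Connected) {x y : V} {r : ℕ} (h : G.dist x y = r + 1) :
    ∃ z, G.Adj z y ∧ G.dist x z ≤ r := by
  obtain ⟨p, h0, hs, he, hd, -⟩ := exists_geodesic hconn x y
  have hy : p (r + 1) = y := he _ h.le
  refine ⟨p r, ?_, hd r⟩
  rcases hs r with h1 | h1
  · have := hd r
    rw [← h1, hy, h] at this
    omega
  · rwa [hy] at h1

theorem finite_ball [G.LocallyFinite] (hconn : G.Connected) (x : V) (r : ℕ) :
    (ball G x r).Finite := by
  induction r with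
  | zero =>
    refine (Set.finite_singleton x).subset fun y hy => ?_
    have : G.dist x y = 0 := by simpa [ball] using hy
    exact ((hconn.dist_eq_zero_iff).1 this).symm
  | succ r ih =>
    refine (ih.union (ih.biUnion fun z _ => (G.neighborFinset z).finite_toSet)).subset ?_
    intro y hy
    rcases Nat.lt_or_ge r (G.dist x y) with h | h
    · obtain ⟨z, hz, hzr⟩ := exists_adj_dist_eq hconn (le_antisymm hy h)
      exact Or.inr (Set.mem_biUnion (x := z) hzr (by simpa using hz))
    · exact Or.inl h

theorem countable_of_connected [G.LocallyFinite] (hconn : G.Connected) : Countable V := by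
  obtain ⟨o⟩ := hconn.nonempty
  rw [← Set.countable_univ_iff]
  have : (Set.univ : Set V) ⊆ ⋃ r, ball G o r := fun y _ =>
    Set.mem_iUnion.2 ⟨G.dist o y, le_refl (G.dist o y)⟩
  exact (Set.countable_iUnion fun r => (finite_ball hconn o r).countable).mono this

theorem coe_encard_eq_ofReal {α : Type*} {s : Set α} (hs : s.Finite) :
    (s.encard : ℝ≥0∞) = ENNReal.ofReal s.ncard := by
  rw [← hs.cast_ncard_eq, ENat.toENNReal_coe, ENNReal.ofReal_natCast]

end Balls

/-! ### The Faber–Krahn inequality under pinched growth -/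

section Pinched

variable {V : Type*} (G : SimpleGraph V) [G.LocallyFinite]

/-- Faber–Krahn inequality at exponential scales: functions supported on a set of at most
`a K ^ r` vertices have Rayleigh quotient at least a constant times `r⁻²`. -/
def RadialFaberKrahn : Prop :=
  ∃ a C K : ℝ, 0 < a ∧ 0 < C ∧ 1 < K ∧ ∀ r : ℕ, 1 ≤ r → ∀ (S : Finset V) (f : V → ℝ),
    (∀ x ∉ S, f x = 0) → (S.card : ℝ) ≤ a * K ^ r →
      normSq f ≤ ENNReal.ofReal (C * r ^ 2) * energy G f

variable {G}

theorem radialFaberKrahn_of_pinched (hconn : G.Connected) (h : HasPinchedExponentialGrowth G) :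
    RadialFaberKrahn G := by
  obtain ⟨C, K, hC, hK, hb⟩ := h
  refine ⟨C⁻¹ / 2, 2 * C ^ 3, K, by positivity, by positivity, hK, fun r hr S f hf hS => ?_⟩
  choose γ γ0 γs γe γd γd' using exists_geodesic hconn
  -- all geodesics of length at most `r`
  let T := {q : V × V // G.dist q.1 q.2 ≤ r}
  have h1 : ∀ j < r, ∀ z, ({t : T | γ t.1.1 t.1.2 j = z}.encard : ℝ≥0∞) ≤
      ENNReal.ofReal (C ^ 2 * K ^ r) := by
    intro j hj z
    have hle : {t : T | γ t.1.1 t.1.2 j = z}.encard ≤ (ball G z j ×ˢ ball G z (r - j)).encard := by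
      refine Set.encard_le_encard_of_injOn (f := Subtype.val) ?_ Subtype.val_injective.injOn
      rintro ⟨⟨x, y⟩, hxy⟩ ht
      have ht' : γ x y j = z := ht
      refine ⟨?_, ?_⟩
      · show G.dist z x ≤ j
        rw [SimpleGraph.dist_comm, ← ht']
        exact γd x y j
      · show G.dist z y ≤ r - j
        rw [← ht']
        exact (γd' x y j).trans (Nat.sub_le_sub_right hxy j)
    have hfin := (finite_ball hconn z j).prod (finite_ball hconn z (r - j))
    refine (ENat.toENNReal_le.2 hle).trans ?_
    rw [coe_encard_eq_ofReal hfin, Set.ncard_prod]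
    refine ENNReal.ofReal_le_ofReal ?_
    push_cast
    calc ((ball G z j).ncard : ℝ) * (ball G z (r - j)).ncard
        ≤ (C * K ^ j) * (C * K ^ (r - j)) := by
          gcongr
          · exact (hb z j).2
          · exact (hb z (r - j)).2
      _ = C ^ 2 * K ^ (j + (r - j)) := by rw [pow_add]; ring
      _ = C ^ 2 * K ^ r := by rw [Nat.add_sub_cancel' hj.le]
  have h0 : ∀ x ∈ S, ENNReal.ofReal (C⁻¹ / 2 * K ^ r) ≤
      ({t : T | γ t.1.1 t.1.2 0 = x ∧ γ t.1.1 t.1.2 r ∉ S}.encard : ℝ≥0∞) := by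
    intro x _
    have hsub : ball G x r \ (S : Set V) ⊆
        (fun t : T => t.1.2) '' {t : T | γ t.1.1 t.1.2 0 = x ∧ γ t.1.1 t.1.2 r ∉ S} := by
      rintro y ⟨hy, hyS⟩
      refine ⟨⟨(x, y), hy⟩, ⟨γ0 x y, ?_⟩, rfl⟩
      show γ x y r ∉ S
      rw [γe x y r hy]
      exact hyS
    refine le_trans ?_ (ENat.toENNReal_le.2 ((Set.encard_le_encard hsub).trans
      (Set.encard_image_le _ _)))
    rw [coe_encard_eq_ofReal ((finite_ball hconn x r).subset Set.sdiff_subset)]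
    refine ENNReal.ofReal_le_ofReal ?_
    have h2 := Set.le_ncard_sdiff (S : Set V) (ball G x r)
    rw [Set.ncard_coe_finset] at h2
    have h3 : ((ball G x r).ncard : ℝ) ≤ (ball G x r \ (S : Set V)).ncard + S.card := by
      exact_mod_cast Nat.sub_le_iff_le_add.1 h2
    linarith [(hb x r).1]
  have key := mul_normSq_le_of_pathFamily (fun t : T => γ t.1.1 t.1.2) r
    (fun t j _ => γs _ _ j) h1 hf h0
  have hpos : 0 < C⁻¹ / 2 * K ^ r := by positivity
  have h4 : ENNReal.ofReal (C⁻¹ / 2 * K ^ r) * normSq f ≤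
      ENNReal.ofReal (C⁻¹ / 2 * K ^ r) * (ENNReal.ofReal (2 * C ^ 3 * r ^ 2) * energy G f) := by
    refine key.trans_eq ?_
    rw [← mul_assoc, ← ENNReal.ofReal_mul hpos.le, ← ENNReal.ofReal_natCast,
      ← ENNReal.ofReal_pow (by positivity), ← ENNReal.ofReal_mul (by positivity)]
    congr 2
    field_simp
  exact (ENNReal.mul_le_mul_iff_right (by simpa using hpos) ENNReal.ofReal_ne_top).1 h4

end Pinched

/-! ### Automorphisms of transitive graphs -/

section Automorphisms

variable {V : Type*} {G : SimpleGraph V}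

theorem dist_iso (hconn : G.Connected) (φ : G ≃g G) (x y : V) :
    G.dist (φ x) (φ y) = G.dist x y := by
  have key : ∀ (ψ : G ≃g G) (x y : V), G.dist (ψ x) (ψ y) ≤ G.dist x y := by
    intro ψ x y
    obtain ⟨w, hw⟩ := hconn.exists_walk_length_eq_dist x y
    rw [← hw, ← SimpleGraph.Walk.length_map ψ.toHom w]
    exact SimpleGraph.dist_le _
  refine le_antisymm (key φ x y) ?_
  simpa using key φ.symm (φ x) (φ y)

/-- The restrictions to `B` of the automorphisms of `G`. -/
abbrev restrictions (G : SimpleGraph V) (B : Set V) : Set (B → V) :=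
  MulAction.orbit (G ≃g G) (Subtype.val : B → V)

theorem finite_restrictions_apply_eq [G.LocallyFinite] (hconn : G.Connected) {B : Set V}
    (hB : B.Finite) (v : B) (x : V) : {e ∈ restrictions G B | e v = x}.Finite := by
  have := hB.to_subtype
  refine (Set.Finite.pi' fun w : B => finite_ball hconn x (G.dist (v : V) w)).subset ?_
  rintro e ⟨⟨φ, rfl⟩, he⟩ w
  show G.dist x (φ w) ≤ _
  rw [← he]
  exact (dist_iso hconn φ v w).le

/-- The number of restrictions to `B` that send `v ∈ B` to `x` does not depend on `x`: it is the
index in the stabilizer of `v` of the pointwise stabilizer of `B`. -/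
theorem ncard_restrictions_apply_eq (htrans : IsTransitive G) {B : Set V} (v : B) (x : V) :
    {e ∈ restrictions G B | e v = x}.ncard =
      (MulAction.stabilizer (G ≃g G) (Subtype.val : B → V)).relIndex
        (MulAction.stabilizer (G ≃g G) (v : V)) := by
  set H := MulAction.stabilizer (G ≃g G) (v : V) with hH
  obtain ⟨φ, hφ⟩ := htrans v x
  have hset : {e ∈ restrictions G B | e v = x} =
      φ • MulAction.orbit H (Subtype.val : B → V) := by
    ext e
    rw [Set.mem_smul_set]
    constructor
    · rintro ⟨⟨ψ, rfl⟩, he⟩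
      have hmem : φ⁻¹ * ψ ∈ H := by
        rw [hH, MulAction.mem_stabilizer_iff, mul_smul, inv_smul_eq_iff]
        exact he.trans hφ.symm
      refine ⟨(φ⁻¹ * ψ) • (Subtype.val : B → V), ⟨⟨_, hmem⟩, rfl⟩, ?_⟩
      simp [mul_smul]
    · rintro ⟨_, ⟨⟨ψ, hψ⟩, rfl⟩, rfl⟩
      refine ⟨⟨φ * ψ, ?_⟩, ?_⟩
      · simp only [mul_smul]; rfl
      · have h1 : ψ (v : V) = v := hψ
        show φ (ψ (v : V)) = x
        rw [h1, hφ]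
  rw [hset, Set.ncard_smul_set, ← MulAction.index_stabilizer]
  rfl

theorem relIndex_stabilizer_ne_zero [G.LocallyFinite] (hconn : G.Connected)
    (htrans : IsTransitive G) {B : Set V} (hB : B.Finite) (v : B) :
    (MulAction.stabilizer (G ≃g G) (Subtype.val : B → V)).relIndex
        (MulAction.stabilizer (G ≃g G) (v : V)) ≠ 0 := by
  rw [← ncard_restrictions_apply_eq htrans v (v : V)]
  exact Set.ncard_ne_zero_of_mem (a := Subtype.val) ⟨MulAction.mem_orbit_self _, rfl⟩
    (finite_restrictions_apply_eq hconn hB v v)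

variable (G) in
/-- The size `[Γ_x : Γ_x ∩ Γ_y]` of the orbit of `y` under the stabilizer of `x` in the
automorphism group. -/
def orbitIndex (x y : V) : ℕ :=
  (MulAction.stabilizer (G ≃g G) y).relIndex (MulAction.stabilizer (G ≃g G) x)

theorem relIndex_stabilizer_eq_mul {B : Set V} (v w : B) :
    (MulAction.stabilizer (G ≃g G) (Subtype.val : B → V)).relIndex
        (MulAction.stabilizer (G ≃g G) (v : V)) =
      (MulAction.stabilizer (G ≃g G) (Subtype.val : B → V)).relIndex
        (MulAction.stabilizer (G ≃g G) (w : V) ⊓ MulAction.stabilizer (G ≃g G) (v : V)) *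
      orbitIndex G v w := by
  have hle : ∀ u : B, MulAction.stabilizer (G ≃g G) (Subtype.val : B → V) ≤
      MulAction.stabilizer (G ≃g G) (u : V) := fun u φ hφ => congrFun hφ u
  rw [orbitIndex, ← Subgroup.inf_relIndex_right (MulAction.stabilizer (G ≃g G) (w : V)),
    Subgroup.relIndex_mul_relIndex _ _ _ (le_inf (hle w) (hle v)) inf_le_right]

theorem orbitIndex_pos [G.LocallyFinite] (hconn : G.Connected) (htrans : IsTransitive G)
    (x y : V) : 0 < orbitIndex G x y := by
  have h := relIndex_stabilizer_ne_zero hconn htrans (Set.toFinite {x, y}) ⟨x, by simp⟩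
  rw [relIndex_stabilizer_eq_mul _ ⟨y, by simp⟩] at h
  exact Nat.pos_of_ne_zero (right_ne_zero_of_mul h)

theorem orbitIndex_iso (φ : G ≃g G) (x y : V) :
    orbitIndex G (φ x) (φ y) = orbitIndex G x y := by
  have h : ∀ z : V, MulAction.stabilizer (G ≃g G) (φ z) =
      (MulAction.stabilizer (G ≃g G) z).map (MulAut.conj φ).toMonoidHom :=
    fun z => MulAction.stabilizer_smul_eq_stabilizer_map_conj φ z
  rw [orbitIndex, orbitIndex, h, h]
  exact Subgroup.relIndex_map_map_of_injective _ _ (MulAut.conj φ).injective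

end Automorphisms

/-! ### The Faber–Krahn inequality on transitive graphs -/

section Transitive

variable {V : Type*} {G : SimpleGraph V} [G.LocallyFinite]

theorem degree_iso (φ : G ≃g G) (x : V) : G.degree (φ x) = G.degree x :=
  φ.degree_eq x

theorem encard_setOf_prod_right {α β : Type*} (Q : α × β → Prop) :
    ({t | Q t}.encard : ℝ≥0∞) = ∑' b, ({a | Q (a, b)}.encard : ℝ≥0∞) := by
  rw [← ENNReal.tsum_set_one, tsum_subtype _ (fun _ => (1 : ℝ≥0∞)),
    ENNReal.tsum_prod', ENNReal.tsum_comm]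
  refine tsum_congr fun b => ?_
  rw [← ENNReal.tsum_set_one, tsum_subtype _ (fun _ => (1 : ℝ≥0∞))]
  rfl

theorem encard_setOf_prod_left {α β : Type*} (Q : α × β → Prop) :
    ({t | Q t}.encard : ℝ≥0∞) = ∑' a, ({b | Q (a, b)}.encard : ℝ≥0∞) := by
  rw [← ENNReal.tsum_set_one, tsum_subtype _ (fun _ => (1 : ℝ≥0∞)), ENNReal.tsum_prod']
  refine tsum_congr fun a => ?_
  rw [← ENNReal.tsum_set_one, tsum_subtype _ (fun _ => (1 : ℝ≥0∞))]
  rfl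

/-- If the modular function is trivial, the images of a fixed family of geodesics from `o` under
all automorphisms are equidistributed, and growth gives the Faber–Krahn inequality. -/
theorem radialFaberKrahn_of_unimodular (hconn : G.Connected) (htrans : IsTransitive G)
    (hgrowth : HasExponentialGrowth G)
    (huni : ∀ x y, G.Adj x y → orbitIndex G x y = orbitIndex G y x) :
    RadialFaberKrahn G := by
  obtain ⟨K, hK, hb⟩ := hgrowth
  obtain ⟨o⟩ := hconn.nonempty
  refine ⟨1 / 2, 2, K, by norm_num, by norm_num, hK, fun r hr S f hf hS => ?_⟩
  choose γ γ0 γs γe γd γd' using exists_geodesic hconn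
  let B : Set V := ball G o r
  have hB : B.Finite := finite_ball hconn o r
  have : Finite B := hB.to_subtype
  have hγB : ∀ y ∈ B, ∀ j, γ o y j ∈ B := by
    intro y hy j
    rcases le_total (G.dist o y) j with h | h
    · rw [γe o y j h]; exact hy
    · exact (γd o y j).trans (h.trans hy)
  let oB : B := ⟨o, by simp [B, ball]⟩
  let N : B → ℕ := fun v => {e ∈ restrictions G B | e v = o}.ncard
  -- the number of restrictions that send `v` to `x` depends neither on `x` nor on `v`
  have hN : ∀ (v : B) (x : V),
      ({e : restrictions G B | e.1 v = x}.encard : ℝ≥0∞) = ENNReal.ofReal (N oB) := by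
    have hstep : ∀ v w : B, (w = v ∨ G.Adj (v : V) w) → N w = N v := by
      rintro v w (rfl | h)
      · rfl
      · simp only [N]
        rw [ncard_restrictions_apply_eq htrans, ncard_restrictions_apply_eq htrans,
          relIndex_stabilizer_eq_mul w v, relIndex_stabilizer_eq_mul v w, huni v w h, inf_comm]
    have hconst : ∀ v : B, N v = N oB := by
      intro v
      have hj : ∀ j, N ⟨γ o v j, hγB v v.2 j⟩ = N oB := by
        intro j
        induction j with
        | zero => congr 1; exact Subtype.ext (γ0 o v)
        | succ j ih =>
          rw [← ih]
          refine hstep _ _ ?_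
          rcases γs o v j with h | h
          · exact Or.inl (Subtype.ext h)
          · exact Or.inr h
      have h2 : (⟨γ o v r, hγB v v.2 r⟩ : B) = v := Subtype.ext (γe o v r v.2)
      rw [← hj r, h2]
    intro v x
    have himg : Subtype.val '' {e : restrictions G B | e.1 v = x} =
        {e ∈ restrictions G B | e v = x} := by
      ext e; simp [and_comm]
    rw [← Subtype.val_injective.injOn.encard_image, himg,
      coe_encard_eq_ofReal (finite_restrictions_apply_eq hconn hB v x),
      ncard_restrictions_apply_eq htrans, ← ncard_restrictions_apply_eq htrans v o]
    rw [show {e ∈ restrictions G B | e v = o}.ncard = N oB from hconst v]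
  have hNpos : 0 < (N oB : ℝ) := by
    have : N oB ≠ 0 := by
      simp only [N]
      rw [ncard_restrictions_apply_eq htrans]
      exact relIndex_stabilizer_ne_zero hconn htrans hB oB
    positivity
  have hBcard : K ^ r ≤ (Nat.card B : ℝ) := by
    rw [Nat.card_coe_set_eq]; exact hb o r hr
  choose g hg using fun e : restrictions G B => e.2
  have hg' : ∀ (e : restrictions G B) (v : B), g e v = e.1 v := fun e v => congrFun (hg e) v
  let p : restrictions G B × B → ℕ → V := fun t j => g t.1 (γ o t.2 j)
  have hpe : ∀ e y j, p (e, y) j = e.1 ⟨γ o y j, hγB y y.2 j⟩ := fun e y j => hg' e ⟨_, _⟩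
  have h1 : ∀ j < r, ∀ x, ({t | p t j = x}.encard : ℝ≥0∞) ≤
      ENNReal.ofReal (Nat.card B * N oB) := by
    intro j _ x
    rw [encard_setOf_prod_right]
    simp_rw [hpe, hN]
    rw [ENNReal.tsum_const, ENat.card_eq_coe_natCard, ENat.toENNReal_coe,
      ENNReal.ofReal_mul (by positivity), ENNReal.ofReal_natCast, ENNReal.ofReal_natCast]
  have h0 : ∀ x ∈ S, ENNReal.ofReal (N oB * (Nat.card B / 2)) ≤
      ({t | p t 0 = x ∧ p t r ∉ S}.encard : ℝ≥0∞) := by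
    intro x _
    rw [encard_setOf_prod_left]
    have hcount : ∀ e : restrictions G B, ENNReal.ofReal (Nat.card B / 2) ≤
        ({y : B | p (e, y) r ∉ S}.encard : ℝ≥0∞) := by
      intro e
      rw [coe_encard_eq_ofReal (Set.toFinite _)]
      refine ENNReal.ofReal_le_ofReal ?_
      have hpy : ∀ y : B, p (e, y) r = g e y := fun y => by
        simp only [p]; rw [γe o y r y.2]
      have h2 : {y : B | p (e, y) r ∈ S}.ncard ≤ S.card := by
        rw [← Set.ncard_coe_finset S]
        refine Set.ncard_le_ncard_of_injOn (fun y : B => g e y)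
          (fun y hy => by simpa [hpy] using hy) ?_ S.finite_toSet
        intro y _ z _ hyz
        exact Subtype.ext ((g e).injective hyz)
      have h3 := Set.ncard_add_ncard_compl {y : B | p (e, y) r ∈ S}
      have h4 : (({y : B | p (e, y) r ∈ S}.ncard : ℝ)) + {y : B | p (e, y) r ∉ S}.ncard =
          Nat.card B := by exact_mod_cast h3
      have h5 : ({y : B | p (e, y) r ∈ S}.ncard : ℝ) ≤ S.card := by exact_mod_cast h2
      linarith
    have hp0 : ∀ e y, p (e, y) 0 = e.1 oB := fun e y => by
      rw [hpe]; exact congrArg e.1 (Subtype.ext (γ0 o y))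
    calc ENNReal.ofReal (N oB * (Nat.card B / 2))
        = ∑' _ : {e : restrictions G B | e.1 oB = x}, ENNReal.ofReal (Nat.card B / 2) := by
          rw [ENNReal.tsum_set_const, hN, ENNReal.ofReal_mul hNpos.le]
      _ ≤ ∑' e : {e : restrictions G B | e.1 oB = x},
            ({y : B | p (e.1, y) 0 = x ∧ p (e.1, y) r ∉ S}.encard : ℝ≥0∞) := by
          refine ENNReal.tsum_le_tsum fun e => (hcount e.1).trans_eq ?_
          congr 3
          ext y
          show _ ↔ _ ∧ _
          rw [hp0]
          exact ⟨fun h => ⟨e.2, h⟩, fun h => h.2⟩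
      _ ≤ _ := ENNReal.tsum_comp_le_tsum_of_injective Subtype.val_injective
            (fun e : restrictions G B =>
              ({y : B | p (e, y) 0 = x ∧ p (e, y) r ∉ S}.encard : ℝ≥0∞))
  have hp : ∀ t, ∀ j < r, p t (j + 1) = p t j ∨ G.Adj (p t j) (p t (j + 1)) := by
    intro t j _
    rcases γs o t.2 j with h | h
    · exact Or.inl (congrArg (g t.1) h)
    · exact Or.inr ((g t.1).map_adj_iff.2 h)
  have key := mul_normSq_le_of_pathFamily p r hp h1 hf h0
  have hBpos : (0 : ℝ) < Nat.card B := lt_of_lt_of_le (by positivity) hBcard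
  have hpos : 0 < (N oB : ℝ) * (Nat.card B / 2) := by positivity
  have h4 : ENNReal.ofReal (N oB * (Nat.card B / 2)) * normSq f ≤
      ENNReal.ofReal (N oB * (Nat.card B / 2)) *
        (ENNReal.ofReal (2 * r ^ 2) * energy G f) := by
    refine key.trans_eq ?_
    rw [← mul_assoc, ← ENNReal.ofReal_mul hpos.le, ← ENNReal.ofReal_natCast,
      ← ENNReal.ofReal_pow (by positivity), ← ENNReal.ofReal_mul (by positivity)]
    congr 2
    ring
  exact (ENNReal.mul_le_mul_iff_right (ENNReal.ofReal_pos.2 hpos).ne' ENNReal.ofReal_ne_top).1 h4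

/-- Mass transport: the modular function sums to the degree over the neighbours of a vertex. -/
theorem sum_orbitIndex_ratio (hconn : G.Connected) (htrans : IsTransitive G) (o : V) :
    ∑ y ∈ G.neighborFinset o, (orbitIndex G y o : ℝ) / orbitIndex G o y = G.degree o := by
  classical
  let B : Set V := insert o (G.neighborFinset o : Set V)
  have hB : B.Finite := (G.neighborFinset o).finite_toSet.insert o
  let oB : B := ⟨o, Set.mem_insert _ _⟩
  have hmem : ∀ y ∈ G.neighborFinset o, y ∈ B := fun y hy => Set.mem_insert_of_mem _ hy
  have hadj : ∀ e ∈ restrictions G B, ∀ v w : B, G.Adj (e v) (e w) ↔ G.Adj (v : V) w := by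
    rintro _ ⟨φ, rfl⟩ v w
    exact φ.map_adj_iff
  -- `M`: the restrictions that send `o` to a neighbour of `o`
  have hMfin : {e ∈ restrictions G B | G.Adj (e oB) o}.Finite := by
    refine ((G.neighborFinset o).finite_toSet.biUnion fun z _ =>
      finite_restrictions_apply_eq hconn hB oB z).subset ?_
    rintro e ⟨he, ha⟩
    exact Set.mem_biUnion (x := e oB) (by simpa using ha.symm) ⟨he, rfl⟩
  set M := hMfin.toFinset with hM
  have hMmem : ∀ e, e ∈ M ↔ e ∈ restrictions G B ∧ G.Adj (e oB) o := fun e => by simp [hM]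
  let N : B → ℕ := fun v =>
    (MulAction.stabilizer (G ≃g G) (Subtype.val : B → V)).relIndex
      (MulAction.stabilizer (G ≃g G) (v : V))
  have c1 : M.card = ∑ z ∈ G.neighborFinset o, N oB := by
    rw [Finset.card_eq_sum_card_fiberwise (f := fun e => e oB) (t := G.neighborFinset o)
      (fun e he => by simpa using ((hMmem e).1 he).2.symm)]
    refine Finset.sum_congr rfl fun z hz => ?_
    simp only [N]
    rw [← ncard_restrictions_apply_eq htrans oB z, ← Set.ncard_coe_finset]
    congr 1
    ext e
    simp only [Finset.coe_filter, hMmem, Set.mem_ofPred_eq]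
    constructor
    · rintro ⟨⟨h1, -⟩, h2⟩; exact ⟨h1, h2⟩
    · rintro ⟨h1, h2⟩
      exact ⟨⟨h1, by rw [h2]; simpa [G.adj_comm] using hz⟩, h2⟩
  have c2 : M.card = ∑ y ∈ (G.neighborFinset o).attach, N ⟨y, hmem y y.2⟩ := by
    have hex : ∀ e ∈ M, ∃ y : G.neighborFinset o, e ⟨y, hmem y y.2⟩ = o := by
      intro e he
      obtain ⟨⟨φ, rfl⟩, ha⟩ := (hMmem e).1 he
      have ha' : G.Adj (φ o) o := ha
      refine ⟨⟨φ.symm o, ?_⟩, φ.apply_symm_apply o⟩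
      rw [SimpleGraph.mem_neighborFinset, ← φ.map_adj_iff]
      simpa using ha'
    have hinj : ∀ e ∈ M, Function.Injective e := by
      intro e he
      obtain ⟨⟨φ, rfl⟩, ha⟩ := (hMmem e).1 he
      exact φ.injective.comp Subtype.val_injective
    have hcard : M.card = ∑ y ∈ (G.neighborFinset o).attach,
        (M.filter fun e => e ⟨y, hmem y y.2⟩ = o).card := by
      simp_rw [Finset.card_filter]
      rw [Finset.sum_comm, Finset.card_eq_sum_ones]
      refine Finset.sum_congr rfl fun e he => ?_
      obtain ⟨y, hy⟩ := hex e he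
      rw [Finset.sum_eq_single y]
      · rw [if_pos hy]
      · intro z _ hz
        rw [if_neg]
        intro h
        exact hz (Subtype.ext (congrArg (fun b : B => (b : V)) (hinj e he (h.trans hy.symm))))
      · simp
    rw [hcard]
    refine Finset.sum_congr rfl fun y _ => ?_
    simp only [N]
    rw [← ncard_restrictions_apply_eq htrans ⟨(y : V), hmem y y.2⟩ o, ← Set.ncard_coe_finset]
    congr 1
    ext e
    simp only [Finset.coe_filter, hMmem, Set.mem_ofPred_eq]
    constructor
    · rintro ⟨⟨h1, -⟩, h2⟩; exact ⟨h1, h2⟩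
    · rintro ⟨h1, h2⟩
      refine ⟨⟨h1, ?_⟩, h2⟩
      have h3 := (hadj e h1 oB ⟨y, hmem y y.2⟩).2
        ((G.mem_neighborFinset o y).1 y.2)
      rwa [h2] at h3
  have hN0 : (N oB : ℝ) ≠ 0 := by
    exact_mod_cast relIndex_stabilizer_ne_zero hconn htrans hB oB
  have hratio : ∀ y : G.neighborFinset o, (orbitIndex G y o : ℝ) / orbitIndex G o y =
      N ⟨y, hmem y y.2⟩ / N oB := by
    intro y
    have e1 := relIndex_stabilizer_eq_mul (G := G) (⟨y, hmem y y.2⟩ : B) oB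
    have e2 := relIndex_stabilizer_eq_mul (G := G) oB (⟨y, hmem y y.2⟩ : B)
    rw [inf_comm] at e2
    set k := (MulAction.stabilizer (G ≃g G) (Subtype.val : B → V)).relIndex
      (MulAction.stabilizer (G ≃g G) ((oB : B) : V) ⊓
        MulAction.stabilizer (G ≃g G) (((⟨y, hmem y y.2⟩ : B)) : V)) with hk
    have e1' : N ⟨y, hmem y y.2⟩ = k * orbitIndex G y o := e1
    have e2' : N oB = k * orbitIndex G o y := e2
    have hk0 : (k : ℝ) ≠ 0 := by
      intro h
      apply hN0
      rw [e2']; push_cast; rw [h, zero_mul]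
    rw [e1', e2']
    push_cast
    rw [mul_div_mul_left _ _ hk0]
  rw [← Finset.sum_attach, Finset.sum_congr rfl fun y _ => hratio y, ← Finset.sum_div,
    div_eq_iff hN0]
  have := c2.symm.trans c1
  rw [Finset.sum_const, SimpleGraph.card_neighborFinset_eq_degree, smul_eq_mul] at this
  exact_mod_cast this

/-- If the modular function is nontrivial, its square root `α` satisfies `α x y * α y x = 1` and,
by strict Cauchy–Schwarz, sums over the neighbours of a vertex to less than the degree; this is a
spectral gap. -/
theorem radialFaberKrahn_of_nonunimodular (hconn : G.Connected) (htrans : IsTransitive G)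
    (hnon : ∃ x y, G.Adj x y ∧ orbitIndex G x y ≠ orbitIndex G y x) :
    RadialFaberKrahn G := by
  obtain ⟨o, y₀, hadj, hne⟩ := hnon
  have hpos : ∀ x y, (0 : ℝ) < orbitIndex G x y := fun x y => by
    exact_mod_cast orbitIndex_pos hconn htrans x y
  let α : V → V → ℝ := fun x y => √((orbitIndex G y x : ℝ) / orbitIndex G x y)
  have hαpos : ∀ x y, 0 < α x y := fun x y => Real.sqrt_pos.2 (div_pos (hpos _ _) (hpos _ _))
  have hαmul : ∀ x y, α x y * α y x = 1 := by
    intro x y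
    simp only [α]
    rw [← Real.sqrt_mul (div_pos (hpos _ _) (hpos _ _)).le, Real.sqrt_eq_one]
    have h1 := (hpos x y).ne'
    have h2 := (hpos y x).ne'
    field_simp
  have hαsq : ∀ x y, α x y ^ 2 = (orbitIndex G y x : ℝ) / orbitIndex G x y := fun x y =>
    Real.sq_sqrt (div_pos (hpos _ _) (hpos _ _)).le
  set s := ∑ y ∈ G.neighborFinset o, α o y with hs
  obtain ⟨d, hd⟩ : ∃ d : ℝ, d = G.degree o := ⟨_, rfl⟩
  have hsx : ∀ x, ∑ y ∈ G.neighborFinset x, α x y = s := by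
    intro x
    obtain ⟨φ, rfl⟩ := htrans o x
    refine (Finset.sum_bij (fun y _ => φ y) ?_ ?_ ?_ ?_).symm
    · intro y hy
      rw [SimpleGraph.mem_neighborFinset] at hy ⊢
      exact φ.map_adj_iff.2 hy
    · intro y _ z _ h; exact φ.injective h
    · intro z hz
      refine ⟨φ.symm z, ?_, by simp⟩
      rw [SimpleGraph.mem_neighborFinset] at hz ⊢
      rw [← φ.map_adj_iff]; simpa using hz
    · intro y _
      simp only [α, orbitIndex_iso]
  have hdx : ∀ x, (G.degree x : ℝ) = d := by
    intro x
    obtain ⟨φ, rfl⟩ := htrans o x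
    rw [degree_iso, hd]
  have hs0 : 0 ≤ s := Finset.sum_nonneg fun y _ => (hαpos o y).le
  have hsd : s < d := by
    have h1 : 0 < ∑ y ∈ G.neighborFinset o, (α o y - 1) ^ 2 := by
      refine Finset.sum_pos' (fun _ _ => sq_nonneg _) ⟨y₀, by simpa using hadj, ?_⟩
      refine sq_pos_of_ne_zero ?_
      intro h
      have h2 : α o y₀ ^ 2 = 1 := by rw [sub_eq_zero.1 h]; norm_num
      rw [hαsq, div_eq_one_iff_eq (hpos _ _).ne'] at h2
      exact hne (by exact_mod_cast h2.symm)
    have h2 : ∑ y ∈ G.neighborFinset o, (α o y - 1) ^ 2 = 2 * (d - s) := by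
      have : ∀ y, (α o y - 1) ^ 2 =
          (orbitIndex G y o : ℝ) / orbitIndex G o y - 2 * α o y + 1 := fun y => by
        rw [← hαsq]; ring
      simp_rw [this]
      rw [Finset.sum_add_distrib, Finset.sum_sub_distrib, sum_orbitIndex_ratio hconn htrans,
        ← Finset.mul_sum, ← hs, Finset.sum_const, SimpleGraph.card_neighborFinset_eq_degree,
        nsmul_eq_mul, mul_one, ← hd]
      ring
    linarith
  refine ⟨1, 1 / (2 * (d - s)), 2, one_pos, by have := sub_pos.2 hsd; positivity, one_lt_two,
    fun r hr S f hf _ => ?_⟩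
  have hfin := normSq_ne_top hf
  have hsum : ∀ c : V → V → ℝ, ∀ t : ℝ, (∀ x y, 0 ≤ c x y) → 0 ≤ t →
      (∀ x, ∑ y ∈ G.neighborFinset x, c x y = t) →
      ∑' x, ∑ y ∈ G.neighborFinset x, ENNReal.ofReal (c x y * f x ^ 2) =
        ENNReal.ofReal t * normSq f := by
    intro c t hc ht hct
    rw [normSq, ← ENNReal.tsum_mul_left]
    refine tsum_congr fun x => ?_
    rw [← ENNReal.ofReal_sum_of_nonneg fun y _ => mul_nonneg (hc x y) (sq_nonneg _),
      ← Finset.sum_mul, hct, ENNReal.ofReal_mul ht]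
  have hA := hsum α s (fun x y => (hαpos x y).le) hs0 hsx
  have hD := hsum (fun _ _ => 1) d (fun _ _ => zero_le_one) (hd ▸ Nat.cast_nonneg _)
    (fun x => by simp [← hdx x])
  have hA' := hA
  rw [tsum_sum_neighborFinset_comm] at hA'
  have hD' := hD
  rw [tsum_sum_neighborFinset_comm] at hD'
  have hineq : ENNReal.ofReal d * normSq f + ENNReal.ofReal d * normSq f ≤
      energy G f + (ENNReal.ofReal s * normSq f + ENNReal.ofReal s * normSq f) := by
    nth_rw 1 [← hD, ← hD', ← hA, ← hA']
    rw [energy, ← ENNReal.tsum_add, ← ENNReal.tsum_add, ← ENNReal.tsum_add]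
    refine ENNReal.tsum_le_tsum fun x => ?_
    simp_rw [← Finset.sum_add_distrib]
    refine Finset.sum_le_sum fun y _ => ?_
    have hx := (hαpos x y).le
    have hy := (hαpos y x).le
    rw [← ENNReal.ofReal_add (by positivity) (by positivity),
      ← ENNReal.ofReal_add (by positivity) (by positivity),
      ← ENNReal.ofReal_add (by positivity) (by positivity)]
    refine ENNReal.ofReal_le_ofReal ?_
    -- `2 f(x) f(y) ≤ α f(x)² + α⁻¹ f(y)²`
    have h1 : 2 * (f x * f y) ≤ α x y * f x ^ 2 + α y x * f y ^ 2 := by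
      have h2 := two_mul_le_add_sq (√(α x y) * f x) (√(α y x) * f y)
      have h3 : √(α x y) * √(α y x) = 1 := by
        rw [← Real.sqrt_mul hx, hαmul, Real.sqrt_one]
      rw [mul_pow, mul_pow, Real.sq_sqrt hx, Real.sq_sqrt hy] at h2
      calc 2 * (f x * f y) = 2 * (√(α x y) * √(α y x)) * (f x * f y) := by rw [h3]; ring
        _ = 2 * (√(α x y) * f x) * (√(α y x) * f y) := by ring
        _ ≤ _ := h2
    nlinarith
  have hgap : ENNReal.ofReal (2 * (d - s)) * normSq f ≤ energy G f := by
    have h1 : ENNReal.ofReal d = ENNReal.ofReal (d - s) + ENNReal.ofReal s := by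
      rw [← ENNReal.ofReal_add (by linarith) hs0]; congr 1; ring
    have hsfin : ENNReal.ofReal s * normSq f + ENNReal.ofReal s * normSq f ≠ ∞ := by
      simp [ENNReal.mul_eq_top, hfin]
    refine (ENNReal.add_le_add_iff_right hsfin).1 (le_trans (le_of_eq ?_) hineq)
    rw [h1, ENNReal.ofReal_mul zero_le_two, ENNReal.ofReal_ofNat]
    ring
  have hds : 0 < 2 * (d - s) := by linarith
  calc normSq f = ENNReal.ofReal (1 / (2 * (d - s))) *
        (ENNReal.ofReal (2 * (d - s)) * normSq f) := by
        rw [← mul_assoc, ← ENNReal.ofReal_mul (by positivity), one_div_mul_cancel hds.ne',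
          ENNReal.ofReal_one, one_mul]
    _ ≤ ENNReal.ofReal (1 / (2 * (d - s)) * r ^ 2) * energy G f := by
        refine mul_le_mul' (ENNReal.ofReal_le_ofReal ?_) hgap
        refine le_mul_of_one_le_right (by positivity) ?_
        exact one_le_pow₀ (by exact_mod_cast hr)

theorem radialFaberKrahn (hconn : G.Connected)
    (h : (IsTransitive G ∧ HasExponentialGrowth G) ∨ HasPinchedExponentialGrowth G) :
    RadialFaberKrahn G := by
  rcases h with ⟨ht, hg⟩ | h
  · by_cases huni : ∀ x y, G.Adj x y → orbitIndex G x y = orbitIndex G y x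
    · exact radialFaberKrahn_of_unimodular hconn ht hg huni
    · push Not at huni
      exact radialFaberKrahn_of_nonunimodular hconn ht huni
  · exact radialFaberKrahn_of_pinched hconn h

end Transitive

/-! ### Dirichlet energy of functions equal to one on a given set -/

section Profile

variable {V : Type*} {G : SimpleGraph V} [G.LocallyFinite]

theorem RadialFaberKrahn.exists_log (h : RadialFaberKrahn G) :
    ∃ C : ℝ, 0 < C ∧ ∀ (S : Finset V) (f : V → ℝ), (∀ x ∉ S, f x = 0) →
      normSq f ≤ ENNReal.ofReal (C * (1 + Real.log S.card) ^ 2) * energy G f := by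
  obtain ⟨a, C, K, ha, hC, hK, h⟩ := h
  have hlK := Real.log_pos hK
  set b := (1 + |Real.log a|) / Real.log K with hb
  have hb0 : 0 < b := by positivity
  refine ⟨C * (b + 1) ^ 2, by positivity, fun S f hf => ?_⟩
  have hL : 0 ≤ Real.log S.card := Real.log_natCast_nonneg _
  set L := Real.log S.card with hLdef
  set r := ⌈b * (1 + L)⌉₊ with hr
  have hr1 : 1 ≤ r := Nat.one_le_ceil_iff.2 (mul_pos hb0 (by linarith))
  have hrle : (r : ℝ) ≤ (b + 1) * (1 + L) := by
    have := (Nat.ceil_lt_add_one (show 0 ≤ b * (1 + L) by positivity)).le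
    rw [← hr] at this
    nlinarith
  have hcard : (S.card : ℝ) ≤ a * K ^ r := by
    rcases S.card.eq_zero_or_pos with h0 | h0
    · rw [h0, Nat.cast_zero]; positivity
    have h0' : (0 : ℝ) < S.card := by exact_mod_cast h0
    rw [← Real.log_le_log_iff h0' (by positivity), Real.log_mul ha.ne' (by positivity),
      Real.log_pow]
    have h1 : b * (1 + L) ≤ r := Nat.le_ceil _
    have h2 : b * (1 + L) * Real.log K = (1 + |Real.log a|) * (1 + L) := by
      rw [hb]; field_simp
    have h3 := mul_le_mul_of_nonneg_right h1 hlK.le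
    have h4 := neg_abs_le (Real.log a)
    have h5 := mul_nonneg (abs_nonneg (Real.log a)) hL
    rw [← hLdef]
    nlinarith
  refine (h r hr1 S f hf hcard).trans ?_
  gcongr ENNReal.ofReal ?_ * _
  calc C * (r : ℝ) ^ 2 ≤ C * ((b + 1) * (1 + L)) ^ 2 := by gcongr
    _ = C * (b + 1) ^ 2 * (1 + L) ^ 2 := by ring

/-- If the superlevel sets at dyadic levels `2⁻ᵏ` of `f` did not satisfy this bound, then the
Faber–Krahn inequality, applied to `f` cut off between consecutive levels, would force them to grow
without bound. -/
theorem RadialFaberKrahn.exists_le_energy (h : RadialFaberKrahn G) :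
    ∃ c : ℝ, 0 < c ∧ ∀ (A S : Finset V) (f : V → ℝ), A.Nonempty → (∀ x ∉ S, f x = 0) →
      (∀ x ∈ A, f x = 1) →
      ENNReal.ofReal (c * A.card / (1 + Real.log A.card) ^ 2) ≤ energy G f := by
  classical
  obtain ⟨C, hC, h⟩ := h.exists_log
  refine ⟨1 / (64 * C), by positivity, fun A S f hA hf hfA => ?_⟩
  by_contra! hlt
  have hn : (1 : ℝ) ≤ A.card := by exact_mod_cast hA.card_pos
  obtain ⟨n, hndef⟩ : ∃ n : ℝ, n = A.card := ⟨_, rfl⟩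
  rw [← hndef] at hn hlt
  have hln : 0 ≤ Real.log n := Real.log_nonneg hn
  have hEtop : energy G f ≠ ∞ := hlt.ne_top
  set e := (energy G f).toReal with he
  have hEe : energy G f = ENNReal.ofReal e := (ENNReal.ofReal_toReal hEtop).symm
  have he0 : 0 ≤ e := ENNReal.toReal_nonneg
  have hsmall : C * e * 64 * (1 + Real.log n) ^ 2 ≤ n := by
    have h1 : e < 1 / (64 * C) * n / (1 + Real.log n) ^ 2 :=
      (ENNReal.lt_ofReal_iff_toReal_lt hEtop).1 hlt
    rw [lt_div_iff₀ (by positivity), div_mul_eq_mul_div, lt_div_iff₀ (by positivity)] at h1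
    linarith
  let level : ℕ → Finset V := fun k => S.filter fun x => (1 / 2 : ℝ) ^ k ≤ f x
  have hcut : ∀ k, (level k).card * (1 / 4 : ℝ) ^ (k + 1) ≤
      C * (1 + Real.log (level (k + 1)).card) ^ 2 * e := by
    intro k
    -- the part of `f` between the levels `2⁻ᵏ⁻¹` and `2⁻ᵏ`
    let φ : ℝ → ℝ := fun t => max (min t ((1 / 2) ^ k) - (1 / 2) ^ (k + 1)) 0
    have hφ : ∀ a b, |φ a - φ b| ≤ |a - b| := by
      intro a b
      have h1 := abs_max_sub_max_le_abs (min a ((1 / 2) ^ k) - (1 / 2) ^ (k + 1))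
        (min b ((1 / 2) ^ k) - (1 / 2) ^ (k + 1)) 0
      have h2 := abs_min_sub_min_le_max a ((1 / 2) ^ k) b ((1 / 2) ^ k)
      rw [sub_sub_sub_cancel_right] at h1
      rw [sub_self, abs_zero, max_eq_left (abs_nonneg _)] at h2
      exact h1.trans h2
    have hsupp : ∀ x ∉ level (k + 1), φ (f x) = 0 := by
      intro x hx
      have hlt : f x < (1 / 2) ^ (k + 1) := by
        by_contra! hge
        apply hx
        refine Finset.mem_filter.2 ⟨?_, hge⟩
        by_contra hxS
        rw [hf x hxS] at hge
        exact absurd hge (not_le.2 (by positivity))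
      exact max_eq_right (by linarith [min_le_left (f x) ((1 / 2) ^ k)])
    have hval : ∀ x ∈ level k, φ (f x) = (1 / 2) ^ (k + 1) := by
      intro x hx
      have h1 : (1 / 2 : ℝ) ^ k ≤ f x := (Finset.mem_filter.1 hx).2
      have h2 : (0 : ℝ) < (1 / 2) ^ (k + 1) := by positivity
      simp only [φ]
      rw [min_eq_right h1, show (1 / 2 : ℝ) ^ k - (1 / 2) ^ (k + 1) = (1 / 2) ^ (k + 1) by
        rw [pow_succ]; ring]
      exact max_eq_left h2.le
    have hlow : ENNReal.ofReal ((level k).card * (1 / 4 : ℝ) ^ (k + 1)) ≤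
        normSq fun x => φ (f x) := by
      calc ENNReal.ofReal ((level k).card * (1 / 4 : ℝ) ^ (k + 1))
          = ∑ x ∈ level k, ENNReal.ofReal (φ (f x) ^ 2) := by
            rw [Finset.sum_congr rfl fun x hx => by rw [hval x hx], Finset.sum_const,
              nsmul_eq_mul, ENNReal.ofReal_mul (Nat.cast_nonneg _), ENNReal.ofReal_natCast,
              ← pow_mul, mul_comm (k + 1), pow_mul,
              show ((1 : ℝ) / 2) ^ 2 = 1 / 4 by norm_num]
        _ ≤ _ := ENNReal.sum_le_tsum _
    have h1 := hlow.trans ((h _ _ hsupp).trans (mul_le_mul_right (energy_comp_le hφ) _))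
    rwa [hEe, ← ENNReal.ofReal_mul (by positivity),
      ENNReal.ofReal_le_ofReal_iff (by positivity)] at h1
  have hgrow : ∀ k, n * 16 ^ k ≤ (level k).card := by
    intro k
    induction k with
    | zero =>
      have : A ⊆ level 0 := fun x hx => by
        refine Finset.mem_filter.2 ⟨?_, by rw [hfA x hx, pow_zero]⟩
        by_contra hxS
        have := hfA x hx
        rw [hf x hxS] at this
        exact zero_ne_one this
      rw [pow_zero, mul_one, hndef]
      exact_mod_cast Finset.card_le_card this
    | succ k ih =>
      obtain ⟨m, hm⟩ : ∃ m : ℝ, m = (level (k + 1)).card := ⟨_, rfl⟩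
      have hck := hcut k
      rw [← hm] at hck ⊢
      have hlm : 0 ≤ Real.log m := hm ▸ Real.log_natCast_nonneg _
      have h1 : n * 16 ^ k * (1 / 4) ^ (k + 1) ≤ C * (1 + Real.log m) ^ 2 * e :=
        le_trans (by gcongr) hck
      have h2 : n * 16 ^ k * (1 / 4) ^ (k + 1) = n * 4 ^ k / 4 := by
        rw [pow_succ, show (16 : ℝ) = 4 * 4 by norm_num, mul_pow, one_div, inv_pow]
        field_simp
      have hn0 : 0 < n := by linarith
      have h3 : (4 * 2 ^ k * (1 + Real.log n)) ^ 2 ≤ (1 + Real.log m) ^ 2 := by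
        -- the choice of `c` as `1 / (64 C)` makes the factor `4 * 2 ^ k` beat `log 16 * (k + 1)`
        have h4 : n * (4 * 2 ^ k * (1 + Real.log n)) ^ 2 ≤ n * (1 + Real.log m) ^ 2 := by
          calc n * (4 * 2 ^ k * (1 + Real.log n)) ^ 2
              = (n * 4 ^ k / 4) * (64 * (1 + Real.log n) ^ 2) := by
                rw [mul_pow, mul_pow, ← pow_mul, mul_comm k 2, pow_mul]; norm_num; ring
            _ ≤ (C * (1 + Real.log m) ^ 2 * e) * (64 * (1 + Real.log n) ^ 2) := by
                rw [← h2]; gcongr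
            _ = (C * e * 64 * (1 + Real.log n) ^ 2) * (1 + Real.log m) ^ 2 := by ring
            _ ≤ n * (1 + Real.log m) ^ 2 := mul_le_mul_of_nonneg_right hsmall (sq_nonneg _)
        exact le_of_mul_le_mul_left h4 hn0
      have h5 : 4 * 2 ^ k * (1 + Real.log n) ≤ 1 + Real.log m :=
        (pow_le_pow_iff_left₀ (by positivity) (by positivity) two_ne_zero).1 h3
      have h6 : ((k + 1 : ℕ) : ℝ) ≤ 2 ^ k := by exact_mod_cast Nat.lt_two_pow_self
      push_cast at h6
      have hlog16 : Real.log 16 ≤ 3 := by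
        rw [show (16 : ℝ) = 2 ^ 4 by norm_num, Real.log_pow]
        push_cast
        linarith [Real.log_two_lt_d9]
      have h7 : Real.log (n * 16 ^ (k + 1)) ≤ Real.log m := by
        rw [Real.log_mul hn0.ne' (by positivity), Real.log_pow]
        push_cast
        have hk : (0 : ℝ) ≤ k := Nat.cast_nonneg k
        have h8 := mul_le_mul_of_nonneg_right h6 (show 0 ≤ 1 + Real.log n by linarith)
        have h9 := mul_nonneg hk hln
        have h10 := mul_le_mul_of_nonneg_left hlog16 (show (0 : ℝ) ≤ k + 1 by linarith)
        nlinarith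
      have hm0 : 0 < m := by
        rcases (Nat.cast_nonneg (α := ℝ) (level (k + 1)).card).eq_or_lt with h0 | h0
        · exfalso
          rw [hm, ← h0, Real.log_zero] at h5
          have : (1 : ℝ) ≤ 2 ^ k := one_le_pow₀ one_le_two
          nlinarith
        · rw [hm]; exact h0
      exact (Real.log_le_log_iff (by positivity) hm0).1 h7
  obtain ⟨k, hk⟩ := pow_unbounded_of_one_lt (S.card : ℝ) (show (1 : ℝ) < 16 by norm_num)
  have h1 : ((level k).card : ℝ) ≤ S.card := by
    exact_mod_cast Finset.card_le_card (Finset.filter_subset _ _)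
  have h2 : (16 : ℝ) ^ k ≤ n * 16 ^ k := le_mul_of_one_le_left (by positivity) hn
  linarith [hgrow k]

end Profile

/-! ### Simple random walk and the capacity -/

section Walk

variable {V : Type*} (G : SimpleGraph V) [G.LocallyFinite]
variable [MeasurableSpace V] [DiscreteMeasurableSpace V]

theorem lintegral_toMeasure [Countable V] (p : PMF V) (g : V → ℝ≥0∞) :
    ∫⁻ y, g y ∂p.toMeasure = ∑' y, g y * p y := by
  rw [lintegral_countable']
  exact tsum_congr fun y => by rw [PMF.toMeasure_apply_singleton _ _ (.of_discrete)]

theorem degree_mul_lintegral_step [Countable V] (g : V → ℝ≥0∞) (x : V) :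
    (G.degree x : ℝ≥0∞) * ∫⁻ y, g y ∂stepKernel G x = ∑ y ∈ G.neighborFinset x, g y := by
  by_cases h : (G.neighborFinset x).Nonempty
  · have hd : (G.degree x : ℝ≥0∞) ≠ 0 := by
      simpa [← SimpleGraph.card_neighborFinset_eq_degree] using h.ne_empty
    show (G.degree x : ℝ≥0∞) * ∫⁻ y, g y ∂(stepPMF G x).toMeasure = _
    rw [lintegral_toMeasure, stepPMF, dif_pos h, tsum_eq_sum (s := G.neighborFinset x)
      (fun y hy => by rw [PMF.uniformOfFinset_apply_of_notMem h hy, mul_zero]), Finset.mul_sum]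
    refine Finset.sum_congr rfl fun y hy => ?_
    rw [PMF.uniformOfFinset_apply_of_mem h hy, SimpleGraph.card_neighborFinset_eq_degree,
      mul_comm (g y), ← mul_assoc, ENNReal.mul_inv_cancel hd (ENNReal.natCast_ne_top _), one_mul]
  · rw [Finset.not_nonempty_iff_eq_empty] at h
    rw [← SimpleGraph.card_neighborFinset_eq_degree, h]
    simp

theorem lintegral_step_eq_one [Countable V] {g : V → ℝ≥0∞} {x : V} (hx : g x = 1)
    (h : ∀ y, G.Adj x y → g y = 1) : ∫⁻ y, g y ∂stepKernel G x = 1 := by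
  by_cases hn : (G.neighborFinset x).Nonempty
  · have hd : (G.degree x : ℝ≥0∞) ≠ 0 := by
      simpa [← SimpleGraph.card_neighborFinset_eq_degree] using hn.ne_empty
    refine (ENNReal.mul_right_inj hd (ENNReal.natCast_ne_top _)).1 ?_
    rw [degree_mul_lintegral_step, Finset.sum_congr rfl fun y hy => h y (by simpa using hy)]
    simp
  · show ∫⁻ y, g y ∂(stepPMF G x).toMeasure = 1
    rw [lintegral_toMeasure, stepPMF, dif_neg hn, tsum_eq_single x (fun y hy => by simp [hy])]
    simp [hx]

/-- The probability that the walk from `x` is not in `A` at the times `1, …, n`, through the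
recursion given by the Markov property at time one. -/
def survival (A : Finset V) : ℕ → V → ℝ≥0∞
  | 0, _ => 1
  | n + 1, x => ∫⁻ y, (A : Set V)ᶜ.indicator (survival A n) y ∂stepKernel G x

/-- Functionals of the first `n` steps are integrated by iterating the transition kernels. -/
theorem lintegral_walkLaw_of_dependsOn {n : ℕ} {f : (ℕ → V) → ℝ≥0∞} (mf : Measurable f)
    (hf : DependsOn f (Finset.Iic n)) (x : V) :
    ∫⁻ X, f X ∂walkLaw G x =
      Kernel.lmarginalPartialTraj (X := fun _ => V) (historyKernel G) 0 n f (fun _ => x) := by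
  have h1 : ∀ X : ℕ → V, f X =
      f (Function.updateFinset (fun _ => x) (Finset.Iic n) (Preorder.frestrictLe n X)) := by
    intro X
    refine hf fun i hi => ?_
    have hi' : i ∈ Finset.Iic n := hi
    simp [Function.updateFinset, Finset.mem_Iic.1 hi']
  rw [lintegral_congr h1, Kernel.lmarginalPartialTraj, walkLaw,
    ← lintegral_map (f := fun z : Finset.Iic n → V =>
      f (Function.updateFinset (fun _ => x) (Finset.Iic n) z)) (μ := Kernel.traj
        (X := fun _ : ℕ => V) (historyKernel G) 0 (fun _ => x)) (g := Preorder.frestrictLe n)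
      (by fun_prop) (by fun_prop), Kernel.traj_map_frestrictLe_apply]
  rfl

theorem measurableSet_avoid (A : Finset V) (n : ℕ) :
    MeasurableSet {X : ℕ → V | ∀ t, 1 ≤ t → t ≤ n → X t ∉ A} := by
  simp only [Set.ofPred_forall]
  refine .iInter fun t => .iInter fun _ => .iInter fun _ => ?_
  exact (MeasurableSet.of_discrete (s := (A : Set V)ᶜ)).preimage (measurable_pi_apply t)

/-- The Markov property: the last of `n + 1` steps, required to avoid `A`, is integrated out. -/
theorem lintegral_walkLaw_avoid (A : Finset V) (n : ℕ) (g : V → ℝ≥0∞) (x : V) :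
    ∫⁻ X, {X : ℕ → V | ∀ t, 1 ≤ t → t ≤ n + 1 → X t ∉ A}.indicator
        (fun X => g (X (n + 1))) X ∂walkLaw G x =
      ∫⁻ X, {X : ℕ → V | ∀ t, 1 ≤ t → t ≤ n → X t ∉ A}.indicator
        (fun X => ∫⁻ y, (A : Set V)ᶜ.indicator g y ∂stepKernel G (X n)) X ∂walkLaw G x := by
  classical
  have hm : ∀ (m : ℕ) (g : V → ℝ≥0∞), Measurable
      ({X : ℕ → V | ∀ t, 1 ≤ t → t ≤ m → X t ∉ A}.indicator fun X => g (X m)) := fun m g =>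
    ((Measurable.of_discrete (f := g)).comp (measurable_pi_apply m)).indicator
      (measurableSet_avoid A m)
  have hdep : ∀ (m : ℕ) (g : V → ℝ≥0∞), DependsOn
      ({X : ℕ → V | ∀ t, 1 ≤ t → t ≤ m → X t ∉ A}.indicator fun X => g (X m))
      (Finset.Iic m) := by
    intro m g X Y hXY
    have h1 : ∀ t ≤ m, X t = Y t := fun t ht => hXY t (Finset.mem_coe.2 (Finset.mem_Iic.2 ht))
    have h2 : (∀ t, 1 ≤ t → t ≤ m → X t ∉ A) ↔ ∀ t, 1 ≤ t → t ≤ m → Y t ∉ A :=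
      forall_congr' fun t => imp_congr_right fun _ => forall_congr' fun ht => by rw [h1 t ht]
    simp only [Set.indicator, Set.mem_ofPred_eq, h2, h1 m le_rfl]
  rw [lintegral_walkLaw_of_dependsOn G (hm (n + 1) g) (hdep (n + 1) g),
    lintegral_walkLaw_of_dependsOn G (hm n fun x => ∫⁻ y, (A : Set V)ᶜ.indicator g y
      ∂stepKernel G x) (hdep n fun x => ∫⁻ y, (A : Set V)ᶜ.indicator g y ∂stepKernel G x),
    ← Kernel.lmarginalPartialTraj_self (Nat.zero_le n) n.le_succ (hm (n + 1) g)]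
  congr 1
  funext X
  rw [Kernel.lmarginalPartialTraj_succ n (hm (n + 1) g)]
  show ∫⁻ y, _ ∂stepKernel G (X n) = _
  by_cases hX : ∀ t, 1 ≤ t → t ≤ n → X t ∉ A
  · rw [Set.indicator_of_mem (show X ∈ {X : ℕ → V | ∀ t, 1 ≤ t → t ≤ n → X t ∉ A} from hX)]
    refine lintegral_congr fun y => ?_
    have : (∀ t, 1 ≤ t → t ≤ n + 1 → Function.update X (n + 1) y t ∉ A) ↔ y ∉ A := by
      constructor
      · intro h
        simpa using h (n + 1) (by omega) le_rfl
      · intro h t h1 h2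
        rcases Nat.lt_or_ge n t with h3 | h3
        · obtain rfl : t = n + 1 := by omega
          simpa using h
        · rw [Function.update_of_ne (by omega)]
          exact hX t h1 h3
    simp [Set.indicator, this]
  · rw [Set.indicator_of_notMem (show X ∉ {X : ℕ → V | ∀ t, 1 ≤ t → t ≤ n → X t ∉ A} from hX)]
    refine (lintegral_congr fun y => ?_).trans lintegral_zero
    refine Set.indicator_of_notMem (fun h => hX fun t h1 h2 => ?_) _
    have := h t h1 (by omega)
    rwa [Function.update_of_ne (by omega)] at this

/-- The recursion of `survival` acts at the first step of the walk, while integrating over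
trajectories removes the last step. The two are matched through the
integral of `survival G A m (X n)` over the trajectories that avoid `A` up to time `n`, which equals
`survival G A (n + m) x`. -/
theorem walkLaw_avoid_eq_survival (A : Finset V) (n : ℕ) (x : V) :
    walkLaw G x {X | ∀ t, 1 ≤ t → t ≤ n → X t ∉ A} = survival G A n x := by
  have key : ∀ n m, ∫⁻ X, {X : ℕ → V | ∀ t, 1 ≤ t → t ≤ n → X t ∉ A}.indicator
      (fun X => survival G A m (X n)) X ∂walkLaw G x = survival G A (n + m) x := by
    intro n
    induction n with
    | zero =>
      intro m
      have hdep : DependsOn (fun X : ℕ → V => survival G A m (X 0)) (Finset.Iic 0) :=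
        fun X Y h => congrArg (survival G A m) (h 0 (by simp))
      have hm : Measurable (fun X : ℕ → V => survival G A m (X 0)) :=
        (Measurable.of_discrete (f := survival G A m)).comp (measurable_pi_apply 0)
      have huniv : {X : ℕ → V | ∀ t, 1 ≤ t → t ≤ 0 → X t ∉ A} = Set.univ :=
        Set.eq_univ_of_forall fun X t h1 h2 => by omega
      rw [huniv, Set.indicator_univ, lintegral_walkLaw_of_dependsOn G hm hdep,
        Kernel.lmarginalPartialTraj_le _ le_rfl hm, zero_add]
    | succ n ih =>
      intro m
      rw [lintegral_walkLaw_avoid, show n + 1 + m = n + (m + 1) by omega, ← ih (m + 1)]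
      rfl
  rw [← add_zero n, ← key n 0]
  simp only [survival, add_zero]
  rw [lintegral_indicator_const (measurableSet_avoid A n), one_mul]

theorem tendsto_survival (A : Finset V) (x : V) :
    Tendsto (fun n => survival G A n x) atTop
      (nhds (ENNReal.ofReal (escapeProb G A x))) := by
  have : IsProbabilityMeasure (walkLaw G x) := by unfold walkLaw; infer_instance
  have hset : {X : ℕ → V | ∀ t, 1 ≤ t → X t ∉ A} =
      ⋂ n, {X : ℕ → V | ∀ t, 1 ≤ t → t ≤ n → X t ∉ A} := by
    ext X
    simp only [Set.mem_iInter]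
    exact ⟨fun h n t h1 _ => h t h1, fun h t h1 => h t t h1 le_rfl⟩
  rw [escapeProb, ofReal_measureReal, hset]
  simp_rw [← walkLaw_avoid_eq_survival]
  exact tendsto_measure_iInter_atTop (fun n => (measurableSet_avoid A n).nullMeasurableSet)
    (fun m n hmn X hX t h1 h2 => hX t h1 (h2.trans hmn)) ⟨0, measure_ne_top _ _⟩

end Walk

/-! ### The capacity lower bound -/

section Capacity

variable {V : Type*} (G : SimpleGraph V) [G.LocallyFinite]
variable [MeasurableSpace V] [DiscreteMeasurableSpace V]

variable {G} in
theorem survival_le_one (A : Finset V) (n : ℕ) (x : V) : survival G A n x ≤ 1 := by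
  induction n generalizing x with
  | zero => exact le_rfl
  | succ n ih =>
    calc survival G A (n + 1) x ≤ ∫⁻ _, 1 ∂stepKernel G x :=
          lintegral_mono fun y => Set.indicator_le (fun y _ => ih y) y
      _ = 1 := by simp

variable {G} in
theorem survival_succ_le (A : Finset V) (n : ℕ) (x : V) :
    survival G A (n + 1) x ≤ survival G A n x := by
  induction n generalizing x with
  | zero => exact survival_le_one A 1 x
  | succ n ih => exact lintegral_mono fun y => Set.indicator_le_indicator (ih y)

/-- The probability that the walk from `x` hits `A` at one of the times `0, …, n`. -/
def hitProb (A : Finset V) (n : ℕ) (x : V) : ℝ :=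
  1 - ((A : Set V)ᶜ.indicator (survival G A n) x).toReal

/-- The walk can only hit `A` by time `n` from within distance `n`. -/
theorem exists_finset_hitProb_eq_zero [Countable V] (A : Finset V) (n : ℕ) :
    ∃ S : Finset V, ∀ x ∉ S, hitProb G A n x = 0 := by
  classical
  have key : ∃ S : Finset V, ∀ x ∉ S, (A : Set V)ᶜ.indicator (survival G A n) x = 1 := by
    induction n with
    | zero => exact ⟨A, fun x hx => Set.indicator_of_mem (by simpa using hx) _⟩
    | succ n ih =>
      obtain ⟨S, hS⟩ := ih
      refine ⟨A ∪ (S ∪ S.biUnion fun y => G.neighborFinset y), fun x hx => ?_⟩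
      simp only [Finset.mem_union, Finset.mem_biUnion, SimpleGraph.mem_neighborFinset,
        not_or, not_exists, not_and] at hx
      rw [Set.indicator_of_mem (by simpa using hx.1)]
      refine lintegral_step_eq_one G (hS x hx.2.1) fun y hy => hS y fun hyS => ?_
      exact hx.2.2 y hyS hy.symm
  obtain ⟨S, hS⟩ := key
  exact ⟨S, fun x hx => by rw [hitProb, hS x hx]; simp⟩

/-- Summation by parts: the hitting probability is superharmonic off `A`, and its Laplacian on `A`
is the probability not to return. -/
theorem energy_hitProb_le [Countable V] (A : Finset V) (n : ℕ) :
    energy G (hitProb G A n) ≤ 2 * ∑ x ∈ A, (G.degree x : ℝ≥0∞) * survival G A (n + 1) x := by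
  classical
  set h := hitProb G A n with hh
  set q : V → ℝ≥0∞ := (A : Set V)ᶜ.indicator (survival G A n) with hq
  have hq1 : ∀ x, q x ≤ 1 := fun x => Set.indicator_le (fun y _ => survival_le_one A n y) x
  have hqtop : ∀ x, q x ≠ ∞ := fun x => ((hq1 x).trans_lt ENNReal.one_lt_top).ne
  have hqr : ∀ x, (q x).toReal ≤ 1 := fun x => ENNReal.toReal_le_of_le_ofReal zero_le_one
    (by simpa using hq1 x)
  have hhx : ∀ x, h x = 1 - (q x).toReal := fun x => rfl
  have h0 : ∀ x, 0 ≤ h x := fun x => sub_nonneg.2 (hqr x)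
  have hadd : ∀ x, ENNReal.ofReal (h x) + q x = 1 := fun x => by
    nth_rw 1 [← ENNReal.ofReal_toReal (hqtop x)]
    rw [← ENNReal.ofReal_add (h0 x) ENNReal.toReal_nonneg, hhx, sub_add_cancel,
      ENNReal.ofReal_one]
  obtain ⟨S, hS⟩ := exists_finset_hitProb_eq_zero G A n
  -- the sum `∑ₓ ∑_{y ∼ x} h x * h y`
  set X : ℝ≥0∞ := ∑' x, ∑ y ∈ G.neighborFinset x, ENNReal.ofReal (h x * h y) with hX
  have hXtop : X ≠ ∞ := by
    rw [hX, tsum_eq_sum (s := S) fun x hx => by simp [hh, hS x hx]]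
    exact ENNReal.sum_ne_top.2 fun x _ => ENNReal.sum_ne_top.2 fun y _ => ENNReal.ofReal_ne_top
  have hsq : energy G h + 2 * X =
      2 * ∑' x, ∑ _y ∈ G.neighborFinset x, ENNReal.ofReal (h x ^ 2) := by
    have h1 : ∑' x, ∑ y ∈ G.neighborFinset x, ENNReal.ofReal (h y ^ 2) =
        ∑' x, ∑ _y ∈ G.neighborFinset x, ENNReal.ofReal (h x ^ 2) :=
      tsum_sum_neighborFinset_comm fun _ y => ENNReal.ofReal (h y ^ 2)
    rw [two_mul (∑' x, ∑ _y ∈ G.neighborFinset x, ENNReal.ofReal (h x ^ 2))]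
    nth_rw 2 [← h1]
    rw [energy, hX, ← ENNReal.tsum_mul_left, ← ENNReal.tsum_add, ← ENNReal.tsum_add]
    refine tsum_congr fun x => ?_
    rw [Finset.mul_sum, ← Finset.sum_add_distrib, ← Finset.sum_add_distrib]
    refine Finset.sum_congr rfl fun y _ => ?_
    have hxy := mul_nonneg (h0 x) (h0 y)
    rw [← ENNReal.ofReal_ofNat 2, ← ENNReal.ofReal_mul zero_le_two,
      ← ENNReal.ofReal_add (sq_nonneg _) (by positivity),
      ← ENNReal.ofReal_add (sq_nonneg _) (sq_nonneg _)]
    congr 1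
    ring
  have hlap : ∀ x, ∑ _y ∈ G.neighborFinset x, ENNReal.ofReal (h x ^ 2) ≤
      ∑ y ∈ G.neighborFinset x, ENNReal.ofReal (h x * h y) +
        if x ∈ A then (G.degree x : ℝ≥0∞) * survival G A (n + 1) x else 0 := by
    intro x
    have hsum : ∑ y ∈ G.neighborFinset x, ENNReal.ofReal (h y) +
        (G.degree x : ℝ≥0∞) * survival G A (n + 1) x = G.degree x := by
      rw [survival, degree_mul_lintegral_step, ← Finset.sum_add_distrib,
        Finset.sum_congr rfl fun y _ => hadd y]
      simp
    have hprod : ∑ y ∈ G.neighborFinset x, ENNReal.ofReal (h x * h y) =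
        ENNReal.ofReal (h x) * ∑ y ∈ G.neighborFinset x, ENNReal.ofReal (h y) := by
      rw [Finset.mul_sum]
      exact Finset.sum_congr rfl fun y _ => ENNReal.ofReal_mul (h0 x)
    rw [hprod, Finset.sum_const, SimpleGraph.card_neighborFinset_eq_degree, nsmul_eq_mul]
    by_cases hx : x ∈ A
    · have hx1 : h x = 1 := by
        rw [hhx, hq, Set.indicator_of_notMem (by simpa using hx)]; simp
      rw [if_pos hx, hx1]
      simp [hsum]
    -- off `A`, `deg x * h x` is at most the sum of `h` over the neighbours of `x`
    · rw [if_neg hx, add_zero, pow_two, ENNReal.ofReal_mul (h0 x), mul_left_comm]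
      gcongr
      have hqx : q x = survival G A n x := Set.indicator_of_mem (by simpa using hx) _
      have hle : (G.degree x : ℝ≥0∞) * survival G A (n + 1) x ≤ G.degree x * q x := by
        rw [hqx]; gcongr; exact survival_succ_le A n x
      have hfin : (G.degree x : ℝ≥0∞) * survival G A (n + 1) x ≠ ∞ :=
        ENNReal.mul_ne_top (ENNReal.natCast_ne_top _)
          ((survival_le_one A (n + 1) x).trans_lt ENNReal.one_lt_top).ne
      refine (ENNReal.add_le_add_iff_right hfin).1 ?_
      rw [hsum]
      refine (add_le_add_right hle _).trans_eq ?_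
      rw [← mul_add, hadd, mul_one]
  have hfin2 : 2 * X ≠ ∞ := ENNReal.mul_ne_top ENNReal.ofNat_ne_top hXtop
  refine (ENNReal.add_le_add_iff_right hfin2).1 ?_
  rw [hsq, ← mul_add]
  gcongr
  refine (ENNReal.tsum_le_tsum hlap).trans_eq ?_
  rw [ENNReal.tsum_add, ← hX, add_comm]
  congr 1
  rw [tsum_eq_sum (s := A) fun x hx => if_neg hx]
  exact Finset.sum_congr rfl fun x hx => if_pos hx

theorem exists_le_capacity [Countable V] [DecidableEq V] (h : RadialFaberKrahn G) :
    ∃ c : ℝ, 0 < c ∧ ∀ A : Finset V, A.Nonempty →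
      c * A.card / (1 + Real.log A.card) ^ 2 ≤ capacity G A := by
  obtain ⟨c, hc, hE⟩ := h.exists_le_energy
  refine ⟨c / 2, by positivity, fun A hA => ?_⟩
  have hcap : ENNReal.ofReal (capacity G A) =
      ∑ x ∈ A, (G.degree x : ℝ≥0∞) * ENNReal.ofReal (escapeProb G A x) := by
    have h0 : ∀ x, 0 ≤ escapeProb G A x := fun x => measureReal_nonneg
    rw [capacity, ENNReal.ofReal_sum_of_nonneg]
    · refine Finset.sum_congr rfl fun x hx => ?_
      rw [equilibriumMeasure, if_pos hx, ENNReal.ofReal_mul (Nat.cast_nonneg _),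
        ENNReal.ofReal_natCast]
    · intro x hx
      rw [equilibriumMeasure, if_pos hx]
      exact mul_nonneg (Nat.cast_nonneg _) (h0 x)
  have hn : ∀ n, ENNReal.ofReal (c * A.card / (1 + Real.log A.card) ^ 2) ≤
      2 * ∑ x ∈ A, (G.degree x : ℝ≥0∞) * survival G A (n + 1) x := by
    intro n
    obtain ⟨S, hS⟩ := exists_finset_hitProb_eq_zero G A n
    refine (hE A S _ hA hS fun x hx => ?_).trans (energy_hitProb_le G A n)
    rw [hitProb, Set.indicator_of_notMem (by simpa using hx)]
    simp
  have hlim : Tendsto (fun n => 2 * ∑ x ∈ A, (G.degree x : ℝ≥0∞) * survival G A (n + 1) x) atTop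
      (nhds (2 * ∑ x ∈ A, (G.degree x : ℝ≥0∞) * ENNReal.ofReal (escapeProb G A x))) := by
    refine ENNReal.Tendsto.const_mul (tendsto_finsetSum _ fun x _ => ?_)
      (Or.inr ENNReal.ofNat_ne_top)
    exact ENNReal.Tendsto.const_mul ((tendsto_add_atTop_iff_nat 1).2 (tendsto_survival G A x))
      (Or.inr (ENNReal.natCast_ne_top _))
  have hle := ge_of_tendsto' hlim hn
  have hcap0 : 0 ≤ capacity G A := Finset.sum_nonneg fun x hx => by
    rw [equilibriumMeasure, if_pos hx]
    exact mul_nonneg (Nat.cast_nonneg _) measureReal_nonneg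
  rw [← hcap, ← ENNReal.ofReal_ofNat 2, ← ENNReal.ofReal_mul zero_le_two,
    ENNReal.ofReal_le_ofReal_iff (by positivity)] at hle
  calc c / 2 * A.card / (1 + Real.log A.card) ^ 2
      = c * A.card / (1 + Real.log A.card) ^ 2 / 2 := by ring
    _ ≤ capacity G A := by linarith

end Capacity

/-! ### Harmonic measure and degrees -/

section HarmonicMeasure

variable {V : Type*} (G : SimpleGraph V) [G.LocallyFinite]

variable {G} in
theorem exists_degree_le (hconn : G.Connected)
    (h : (IsTransitive G ∧ HasExponentialGrowth G) ∨ HasPinchedExponentialGrowth G) :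
    ∃ D : ℕ, ∀ x, G.degree x ≤ D := by
  rcases h with ⟨ht, -⟩ | ⟨C, K, hC, hK, hb⟩
  · obtain ⟨o⟩ := hconn.nonempty
    refine ⟨G.degree o, fun x => ?_⟩
    obtain ⟨φ, rfl⟩ := ht o x
    rw [degree_iso]
  · refine ⟨⌈C * K ^ 1⌉₊, fun x => ?_⟩
    have h1 : G.degree x ≤ (ball G x 1).ncard := by
      rw [← SimpleGraph.card_neighborFinset_eq_degree, ← Set.ncard_coe_finset]
      refine Set.ncard_le_ncard (fun y hy => ?_) (finite_ball hconn x 1)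
      exact (SimpleGraph.dist_eq_one_iff_adj.2 (by simpa using hy)).le
    have h2 : ((ball G x 1).ncard : ℝ) ≤ ⌈C * K ^ 1⌉₊ := (hb x 1).2.trans (Nat.le_ceil _)
    exact h1.trans (by exact_mod_cast h2)

theorem card_outerBoundary_le [DecidableEq V] {D : ℕ} (hD : ∀ x, G.degree x ≤ D) (B : Finset V) :
    (outerBoundary G B).card ≤ D * B.card := by
  calc (outerBoundary G B).card ≤ (B.biUnion fun y => G.neighborFinset y).card :=
        Finset.card_le_card Finset.sdiff_subset
    _ ≤ ∑ y ∈ B, (G.neighborFinset y).card := Finset.card_biUnion_le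
    _ ≤ ∑ _y ∈ B, D := Finset.sum_le_sum fun y _ => by
        rw [SimpleGraph.card_neighborFinset_eq_degree]; exact hD y
    _ = D * B.card := by rw [Finset.sum_const, smul_eq_mul, mul_comm]

theorem exists_harmonicMeasure_le [MeasurableSpace V] [DiscreteMeasurableSpace V] [Countable V]
    [DecidableEq V] (h : RadialFaberKrahn G) {D : ℕ} (hD : ∀ x, G.degree x ≤ D) :
    ∃ C : ℝ, 0 < C ∧ ∀ (t : ℕ) (B : Finset V) (x : V), B.card = t + 1 →
      harmonicMeasure G (B ∪ outerBoundary G B) x ≤ C * (1 + Real.log (t + 1)) ^ 2 / (t + 1) := by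
  obtain ⟨c, hc, hcap⟩ := exists_le_capacity G h
  refine ⟨(D + 1) * (1 + Real.log (D + 1)) ^ 2 / c, ?_, fun t B x hB => ?_⟩
  · have : 0 ≤ Real.log ((D : ℝ) + 1) := Real.log_nonneg (by linarith [Nat.cast_nonneg (α := ℝ) D])
    positivity
  set A := B ∪ outerBoundary G B with hA
  have hAne : A.Nonempty := (Finset.card_pos.1 (by omega : 0 < B.card)).mono
    Finset.subset_union_left
  have hlow : (t : ℝ) + 1 ≤ A.card := by
    have := Finset.card_le_card (Finset.subset_union_left : B ⊆ A)
    rw [hB] at this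
    exact_mod_cast this
  have hup : (A.card : ℝ) ≤ (D + 1) * (t + 1) := by
    have h1 := Finset.card_union_le B (outerBoundary G B)
    have h2 := card_outerBoundary_le G hD B
    have h3 : A.card ≤ (D + 1) * (t + 1) := by
      rw [← hB]; calc A.card ≤ B.card + D * B.card := h1.trans (by omega)
        _ = (D + 1) * B.card := by ring
    exact_mod_cast h3
  have ht0 : (0 : ℝ) < t + 1 := by positivity
  have hD0 : (0 : ℝ) < (D : ℝ) + 1 := by positivity
  have hA0 : (0 : ℝ) < A.card := by linarith
  have hlD : 0 ≤ Real.log ((D : ℝ) + 1) :=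
    Real.log_nonneg (by linarith [Nat.cast_nonneg (α := ℝ) D])
  have hlt : 0 ≤ Real.log ((t : ℝ) + 1) :=
    Real.log_nonneg (by linarith [Nat.cast_nonneg (α := ℝ) t])
  have hlA : 0 ≤ Real.log (A.card : ℝ) := Real.log_natCast_nonneg _
  have hlog : 1 + Real.log A.card ≤ (1 + Real.log (D + 1)) * (1 + Real.log (t + 1)) := by
    have := Real.log_le_log hA0 hup
    rw [Real.log_mul hD0.ne' ht0.ne'] at this
    nlinarith
  have hcap0 : 0 < c * A.card / (1 + Real.log A.card) ^ 2 := by positivity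
  have he : equilibriumMeasure G A x ≤ D + 1 := by
    have h1 : escapeProb G A x ≤ 1 := by
      have : IsProbabilityMeasure (walkLaw G x) := by unfold walkLaw; infer_instance
      exact measureReal_le_one
    have h2 : (G.degree x : ℝ) ≤ D := by exact_mod_cast hD x
    rw [equilibriumMeasure]
    split_ifs
    · calc (G.degree x : ℝ) * escapeProb G A x ≤ G.degree x * 1 := by gcongr
        _ ≤ D + 1 := by linarith
    · positivity
  calc harmonicMeasure G A x ≤ (D + 1) / (c * A.card / (1 + Real.log A.card) ^ 2) :=
        div_le_div₀ hD0.le he hcap0 (hcap A hAne)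
    _ = (D + 1) * (1 + Real.log A.card) ^ 2 / (c * A.card) := by field_simp
    _ ≤ (D + 1) * ((1 + Real.log (D + 1)) * (1 + Real.log (t + 1))) ^ 2 / (c * (t + 1)) := by
        gcongr
    _ = (D + 1) * (1 + Real.log (D + 1)) ^ 2 / c * (1 + Real.log (t + 1)) ^ 2 / (t + 1) := by
        field_simp

end HarmonicMeasure

/-! ### Exponential moments of the aggregate -/

section Weight

variable {V : Type*} (G : SimpleGraph V)

/-- The weight `∑_{x ∈ A} 2 ^ dist(o, x)`, an upper bound for `2 ^ rad(A)`. -/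
def expWeight (o : V) (A : Finset V) : ℝ≥0∞ := ∑ x ∈ A, 2 ^ G.dist o x

theorem two_pow_rad_le_expWeight (o : V) {A : Finset V} (hA : A.Nonempty) :
    2 ^ rad G o A ≤ expWeight G o A := by
  obtain ⟨x, hx, hr⟩ := Finset.exists_mem_eq_sup A hA fun x => G.dist o x
  rw [rad, hr]
  exact Finset.single_le_sum (f := fun x => (2 : ℝ≥0∞) ^ G.dist o x) (fun _ _ => zero_le) hx

theorem expWeight_outerBoundary_le [G.LocallyFinite] [DecidableEq V] (hconn : G.Connected) {D : ℕ}
    (hD : ∀ x, G.degree x ≤ D) (o : V) (B : Finset V) :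
    expWeight G o (outerBoundary G B) ≤ 2 * D * expWeight G o B := by
  calc expWeight G o (outerBoundary G B)
      ≤ ∑ x ∈ B.biUnion (fun y => G.neighborFinset y), (2 : ℝ≥0∞) ^ G.dist o x :=
        Finset.sum_le_sum_of_subset Finset.sdiff_subset
    _ ≤ ∑ y ∈ B, ∑ x ∈ G.neighborFinset y, (2 : ℝ≥0∞) ^ G.dist o x := by
        rw [← Finset.sum_comm' (s := B.biUnion fun y => G.neighborFinset y)
          (t := fun x => B.filter fun y => x ∈ G.neighborFinset y)
          (by simp only [Finset.mem_biUnion, Finset.mem_filter]; tauto)]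
        refine Finset.sum_le_sum fun x hx => ?_
        obtain ⟨y, hy, hxy⟩ := Finset.mem_biUnion.1 hx
        exact Finset.single_le_sum (f := fun _ => (2 : ℝ≥0∞) ^ G.dist o x) (fun _ _ => zero_le)
          (Finset.mem_filter.2 ⟨hy, hxy⟩)
    _ ≤ ∑ y ∈ B, ∑ _x ∈ G.neighborFinset y, 2 * (2 : ℝ≥0∞) ^ G.dist o y := by
        refine Finset.sum_le_sum fun y _ => Finset.sum_le_sum fun x hx => ?_
        have h1 : G.dist y x = 1 := SimpleGraph.dist_eq_one_iff_adj.2 (by simpa using hx)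
        have h2 : G.dist o x ≤ G.dist o y + 1 := h1 ▸ hconn.dist_triangle
        rw [← pow_succ']
        exact pow_le_pow_right₀ (by norm_num) h2
    _ ≤ ∑ y ∈ B, D * (2 * (2 : ℝ≥0∞) ^ G.dist o y) := by
        refine Finset.sum_le_sum fun y _ => ?_
        rw [Finset.sum_const, SimpleGraph.card_neighborFinset_eq_degree, nsmul_eq_mul]
        gcongr
        exact hD y
    _ = 2 * D * expWeight G o B := by
        rw [expWeight, Finset.mul_sum]
        exact Finset.sum_congr rfl fun y _ => by ring

end Weight

/-! ### Growth of the aggregate -/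

section Growth

variable {V : Type*} [DecidableEq V] [MeasurableSpace V] [DiscreteMeasurableSpace V]
  {G : SimpleGraph V} [G.LocallyFinite] {o : V} {Ω : Type*} [MeasurableSpace Ω] {P : Measure Ω}
  {A : ℕ → Ω → Finset V}

theorem IsDLA.ae_card_eq (hA : IsDLA G {o} P A) : ∀ᵐ ω ∂P, ∀ t, (A t ω).card = t + 1 := by
  filter_upwards [hA.init, hA.growth] with ω h0 hg t
  induction t with
  | zero => simp [h0]
  | succ t ih =>
    obtain ⟨x, hx, hxt⟩ := hg t
    rw [hxt, Finset.card_insert_of_notMem (Finset.mem_sdiff.1 hx).2, ih]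

theorem IsDLA.measurable_comp [Countable V] (hA : IsDLA G {o} P A) (t : ℕ)
    (F : Finset V → ℝ≥0∞) : Measurable fun ω => F (A t ω) := by
  let _ : MeasurableSpace (Finset V) := ⊤
  have h : Measurable (A t) := measurable_to_countable' fun B => hA.measurableSet_eq t B
  exact (measurable_from_top (f := F)).comp h

/-- One step of the aggregation multiplies the expected weight by at most `1 + 2 D b`, where `b`
bounds the harmonic measure of every vertex. -/
theorem IsDLA.lintegral_expWeight_succ_le [Countable V] [IsProbabilityMeasure P]
    (hconn : G.Connected) (hA : IsDLA G {o} P A) {D : ℕ} (hD : ∀ x, G.degree x ≤ D) (t : ℕ) {b : ℝ}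
    (hb0 : 0 ≤ b) (hb : ∀ (B : Finset V) (x : V), B.card = t + 1 →
      harmonicMeasure G (B ∪ outerBoundary G B) x ≤ b) :
    ∫⁻ ω, expWeight G o (A (t + 1) ω) ∂P ≤
      ENNReal.ofReal (1 + 2 * D * b) * ∫⁻ ω, expWeight G o (A t ω) ∂P := by
  -- the histories up to time `t`, extended by `∅`
  let ext : (Fin (t + 1) → Finset V) → ℕ → Finset V := fun h i =>
    if hi : i < t + 1 then h ⟨i, hi⟩ else ∅
  let E : (Fin (t + 1) → Finset V) → Set Ω := fun h => {ω | ∀ i ≤ t, A i ω = ext h i}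
  have hEm : ∀ h, MeasurableSet (E h) := by
    intro h
    simp only [E, Set.ofPred_forall]
    exact .iInter fun i => .iInter fun _ => hA.measurableSet_eq i _
  have hEd : Pairwise (Function.onFun Disjoint E) := by
    intro h h' hne
    refine Set.disjoint_left.2 fun ω hω hω' => hne ?_
    funext i
    have h1 := (hω i (Nat.lt_succ_iff.1 i.2)).symm.trans (hω' i (Nat.lt_succ_iff.1 i.2))
    simpa only [ext, dif_pos i.2] using h1
  have hEu : ⋃ h, E h = Set.univ := by
    refine Set.eq_univ_of_forall fun ω => Set.mem_iUnion.2 ⟨fun i => A i ω, fun i hi => ?_⟩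
    simp only [ext, dif_pos (Nat.lt_succ_iff.2 hi)]
  have hsplit : ∀ F : Ω → ℝ≥0∞, ∫⁻ ω, F ω ∂P = ∑' h, ∫⁻ ω in E h, F ω ∂P := by
    intro F
    rw [← lintegral_iUnion hEm hEd, hEu, setLIntegral_univ]
  rw [hsplit, hsplit, ← ENNReal.tsum_mul_left]
  refine ENNReal.tsum_le_tsum fun h => ?_
  set B := ext h t with hB
  have hright : ∫⁻ ω in E h, expWeight G o (A t ω) ∂P = expWeight G o B * P (E h) := by
    rw [setLIntegral_congr_fun (hEm h) fun ω hω => by rw [hω t le_rfl], setLIntegral_const]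
  rw [hright]
  rcases eq_or_ne (P (E h)) 0 with h0 | h0
  · rw [setLIntegral_measure_zero _ _ h0]; exact zero_le
  have hcard : B.card = t + 1 := by
    by_contra hne
    refine h0 (measure_mono_null (t := {ω | ¬ ∀ t, (A t ω).card = t + 1})
      (fun ω hω hc => hne ?_) (ae_iff.1 hA.ae_card_eq))
    rw [hB, ← hω t le_rfl]
    exact hc t
  let J : V → Set Ω := fun x => {ω | A (t + 1) ω = insert x B}
  have hJm : ∀ x, MeasurableSet (J x) := fun x => hA.measurableSet_eq (t + 1) _
  have hJP : ∀ x ∈ outerBoundary G B, P (J x ∩ E h) ≤ ENNReal.ofReal b * P (E h) := by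
    intro x hx
    have htr := hA.transition t (ext h) x hx
    have hset : {ω | (∀ i ≤ t, A i ω = ext h i) ∧ A (t + 1) ω = insert x (ext h t)} =
        J x ∩ E h := by
      ext ω; exact and_comm
    rw [hset] at htr
    have h1 : P.real (J x ∩ E h) ≤ b * P.real (E h) := by
      rw [htr, mul_comm b]
      exact mul_le_mul_of_nonneg_left (hb B x hcard) measureReal_nonneg
    rw [← ofReal_measureReal (measure_ne_top P (J x ∩ E h)),
      ← ofReal_measureReal (measure_ne_top P (E h)), ← ENNReal.ofReal_mul hb0]
    exact ENNReal.ofReal_le_ofReal h1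
  have hpt : ∀ᵐ ω ∂P.restrict (E h), expWeight G o (A (t + 1) ω) ≤
      expWeight G o B + ∑ x ∈ outerBoundary G B, (J x).indicator (fun _ => 2 ^ G.dist o x) ω := by
    rw [ae_restrict_iff' (hEm h)]
    filter_upwards [hA.growth] with ω hg hω
    obtain ⟨x, hx, hxt⟩ := hg t
    rw [hω t le_rfl] at hx hxt
    have hxB : x ∉ B := (Finset.mem_sdiff.1 hx).2
    rw [hxt, expWeight, Finset.sum_insert hxB, add_comm]
    gcongr
    · exact le_rfl
    · refine le_trans (le_of_eq ?_) (Finset.single_le_sum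
        (f := fun x => (J x).indicator (fun _ => (2 : ℝ≥0∞) ^ G.dist o x) ω)
        (fun _ _ => zero_le) hx)
      exact (Set.indicator_of_mem (show ω ∈ J x from hxt) fun _ => (2 : ℝ≥0∞) ^ G.dist o x).symm
  calc ∫⁻ ω in E h, expWeight G o (A (t + 1) ω) ∂P
      ≤ ∫⁻ ω in E h, (expWeight G o B +
          ∑ x ∈ outerBoundary G B, (J x).indicator (fun _ => 2 ^ G.dist o x) ω) ∂P :=
        lintegral_mono_ae hpt
    _ = expWeight G o B * P (E h) +
          ∑ x ∈ outerBoundary G B, 2 ^ G.dist o x * P (J x ∩ E h) := by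
        rw [lintegral_add_left measurable_const, setLIntegral_const,
          lintegral_finsetSum _ fun x _ => measurable_const.indicator (hJm x)]
        congr 1
        refine Finset.sum_congr rfl fun x _ => ?_
        rw [lintegral_indicator_const (hJm x), Measure.restrict_apply (hJm x)]
    _ ≤ expWeight G o B * P (E h) +
          ∑ x ∈ outerBoundary G B, 2 ^ G.dist o x * (ENNReal.ofReal b * P (E h)) := by
        gcongr with x hx
        exact hJP x hx
    _ = expWeight G o B * P (E h) +
          expWeight G o (outerBoundary G B) * (ENNReal.ofReal b * P (E h)) := by
        rw [expWeight, expWeight, Finset.sum_mul, Finset.sum_mul]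
    _ ≤ expWeight G o B * P (E h) +
          2 * D * expWeight G o B * (ENNReal.ofReal b * P (E h)) := by
        gcongr
        exact expWeight_outerBoundary_le G hconn hD o B
    _ = ENNReal.ofReal (1 + 2 * D * b) * (expWeight G o B * P (E h)) := by
        rw [ENNReal.ofReal_add zero_le_one (by positivity), ENNReal.ofReal_one,
          ENNReal.ofReal_mul (by positivity), ENNReal.ofReal_mul zero_le_two,
          ENNReal.ofReal_natCast, ENNReal.ofReal_ofNat]
        ring

theorem sum_range_log_sq_div_le {C : ℝ} (hC : 0 ≤ C) (T : ℕ) :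
    ∑ t ∈ Finset.range T, C * (1 + Real.log (t + 1)) ^ 2 / (t + 1) ≤
      C * (1 + Real.log (T + 1)) ^ 3 := by
  have hT : 0 ≤ Real.log ((T : ℝ) + 1) := Real.log_nonneg (by linarith [Nat.cast_nonneg (α := ℝ) T])
  calc ∑ t ∈ Finset.range T, C * (1 + Real.log (t + 1)) ^ 2 / (t + 1)
      ≤ ∑ t ∈ Finset.range T, C * (1 + Real.log (T + 1)) ^ 2 * ((t : ℝ) + 1)⁻¹ := by
        refine Finset.sum_le_sum fun t ht => ?_
        have htT : (t : ℝ) ≤ T := by exact_mod_cast (Finset.mem_range.1 ht).le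
        have ht0 : 0 ≤ Real.log ((t : ℝ) + 1) :=
          Real.log_nonneg (by linarith [Nat.cast_nonneg (α := ℝ) t])
        rw [div_eq_mul_inv]
        gcongr
    _ = C * (1 + Real.log (T + 1)) ^ 2 * (harmonic T : ℝ) := by
        rw [← Finset.mul_sum, harmonic]; push_cast; rfl
    _ ≤ C * (1 + Real.log (T + 1)) ^ 2 * (1 + Real.log (T + 1)) := by
        gcongr
        refine (harmonic_le_one_add_log T).trans ?_
        rcases T.eq_zero_or_pos with rfl | h0
        · simp
        · gcongr
          linarith
    _ = C * (1 + Real.log (T + 1)) ^ 3 := by ring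

/-- The steps multiply the expected weight by factors `1 + a t ≤ exp (a t)` with
`∑_{t < T} a t = O((log T)³)`. -/
theorem IsDLA.exists_lintegral_expWeight_le [Countable V] [IsProbabilityMeasure P]
    (hconn : G.Connected) (hA : IsDLA G {o} P A) (hFK : RadialFaberKrahn G) {D : ℕ}
    (hD : ∀ x, G.degree x ≤ D) :
    ∃ C : ℝ, 0 ≤ C ∧ ∀ T : ℕ, ∫⁻ ω, expWeight G o (A T ω) ∂P ≤
      ENNReal.ofReal (Real.exp (C * (1 + Real.log (T + 1)) ^ 3)) := by
  obtain ⟨C, hC, hharm⟩ := exists_harmonicMeasure_le G hFK hD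
  refine ⟨2 * D * C, by positivity, fun T => ?_⟩
  have key : ∫⁻ ω, expWeight G o (A T ω) ∂P ≤ ENNReal.ofReal (Real.exp
      (∑ t ∈ Finset.range T, 2 * D * C * (1 + Real.log (t + 1)) ^ 2 / (t + 1))) := by
    induction T with
    | zero =>
      have h1 : ∫⁻ ω, expWeight G o (A 0 ω) ∂P = ∫⁻ _, 1 ∂P := by
        refine lintegral_congr_ae ?_
        filter_upwards [hA.init] with ω h0
        simp [h0, expWeight]
      rw [h1]
      simp
    | succ T ih =>
      have hb0 : 0 ≤ C * (1 + Real.log (T + 1)) ^ 2 / ((T : ℝ) + 1) := by positivity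
      refine (hA.lintegral_expWeight_succ_le hconn hD T hb0 (hharm T)).trans ?_
      refine (mul_le_mul_right ih _).trans ?_
      rw [← ENNReal.ofReal_mul (by positivity), Finset.sum_range_succ, Real.exp_add,
        mul_comm (Real.exp _)]
      refine ENNReal.ofReal_le_ofReal (mul_le_mul_of_nonneg_right ?_ (Real.exp_nonneg _))
      calc 1 + 2 * D * (C * (1 + Real.log (T + 1)) ^ 2 / ((T : ℝ) + 1))
          = 2 * D * C * (1 + Real.log (T + 1)) ^ 2 / ((T : ℝ) + 1) + 1 := by ring
        _ ≤ _ := Real.add_one_le_exp _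
  exact key.trans (ENNReal.ofReal_le_ofReal (Real.exp_le_exp.2
    (sum_range_log_sq_div_le (by positivity) T)))

/-- Almost surely the radius is eventually at most a constant times `(log T)³`. -/
theorem IsDLA.exists_ae_rad_le [Countable V] [IsProbabilityMeasure P]
    (hconn : G.Connected) (hA : IsDLA G {o} P A) (hFK : RadialFaberKrahn G) {D : ℕ}
    (hD : ∀ x, G.degree x ≤ D) :
    ∃ C : ℝ, 0 ≤ C ∧ ∀ᵐ ω ∂P, ∀ᶠ T : ℕ in atTop,
      (rad G o (A T ω) : ℝ) * Real.log 2 ≤ C * (1 + Real.log (T + 1)) ^ 3 := by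
  obtain ⟨C, hC, hE⟩ := hA.exists_lintegral_expWeight_le hconn hFK hD
  refine ⟨2 + C, by positivity, ?_⟩
  let s : ℕ → Set Ω := fun T => {ω | ENNReal.ofReal (((T : ℝ) + 1) ^ 2 *
    Real.exp (C * (1 + Real.log (T + 1)) ^ 3)) ≤ expWeight G o (A T ω)}
  -- Markov's inequality; the factor `(T + 1)²` makes the bounds summable
  have hs : ∀ T, P (s T) ≤ ENNReal.ofReal (1 / ((T + 1 : ℕ) : ℝ) ^ 2) := by
    intro T
    have hpos : 0 < ((T : ℝ) + 1) ^ 2 * Real.exp (C * (1 + Real.log (T + 1)) ^ 3) := by positivity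
    refine (meas_ge_le_lintegral_div (hA.measurable_comp T _).aemeasurable
      (ENNReal.ofReal_pos.2 hpos).ne' ENNReal.ofReal_ne_top).trans ?_
    refine (ENNReal.div_le_div_right (hE T) _).trans ?_
    rw [← ENNReal.ofReal_div_of_pos hpos]
    refine ENNReal.ofReal_le_ofReal (le_of_eq ?_)
    push_cast
    field_simp
  have hsum : ∑' T, P (s T) ≠ ∞ := by
    refine ne_top_of_le_ne_top ?_ (ENNReal.tsum_le_tsum hs)
    have h1 : Summable fun T : ℕ => 1 / ((T + 1 : ℕ) : ℝ) ^ 2 :=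
      (summable_nat_add_iff 1).2 (Real.summable_one_div_nat_pow.2 one_lt_two)
    rw [← ENNReal.ofReal_tsum_of_nonneg (fun T => by positivity) h1]
    exact ENNReal.ofReal_ne_top
  filter_upwards [ae_eventually_notMem hsum, hA.ae_card_eq] with ω hω hcard
  filter_upwards [hω] with T hT
  have hne : (A T ω).Nonempty := Finset.card_pos.1 (by rw [hcard T]; omega)
  have h1 := (two_pow_rad_le_expWeight G o hne).trans (not_le.1 hT).le
  have h2 : (2 : ℝ) ^ rad G o (A T ω) ≤
      ((T : ℝ) + 1) ^ 2 * Real.exp (C * (1 + Real.log (T + 1)) ^ 3) := by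
    rwa [← ENNReal.ofReal_ofNat 2, ← ENNReal.ofReal_pow zero_le_two,
      ENNReal.ofReal_le_ofReal_iff (by positivity)] at h1
  have h3 := Real.log_le_log (by positivity) h2
  rw [Real.log_pow, Real.log_mul (by positivity) (Real.exp_ne_zero _), Real.log_exp,
    Real.log_pow] at h3
  have hL : 0 ≤ Real.log ((T : ℝ) + 1) := Real.log_nonneg (by linarith [Nat.cast_nonneg (α := ℝ) T])
  push_cast at h3
  nlinarith [pow_nonneg hL 2, pow_nonneg hL 3]

end Growth

end DLA

end

theorem mainTheorem2 {V : Type*} [DecidableEq V] [MeasurableSpace V] [DiscreteMeasurableSpace V]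
    (G : SimpleGraph V) [G.LocallyFinite] (hconn : G.Connected)
    (hgrowth : (DLA.IsTransitive G ∧ DLA.HasExponentialGrowth G) ∨
      DLA.HasPinchedExponentialGrowth G)
    (o : V) {Ω : Type*} [MeasurableSpace Ω] (P : Measure Ω) [IsProbabilityMeasure P]
    (A : ℕ → Ω → Finset V) (hA : DLA.IsDLA G {o} P A) :
    ∀ᵐ ω ∂P,
      limsup (fun t : ℕ => ((Real.log t ^ (-4 : ℤ) * (DLA.rad G o (A t ω) : ℝ) : ℝ) : EReal))
        atTop < ⊤ := by
  have := DLA.countable_of_connected hconn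
  obtain ⟨D, hD⟩ := DLA.exists_degree_le hconn hgrowth
  obtain ⟨C, hC, hrad⟩ := hA.exists_ae_rad_le hconn (DLA.radialFaberKrahn hconn hgrowth) hD
  filter_upwards [hrad] with ω hω
  refine lt_of_le_of_lt (limsup_le_of_le (h := ?_)) (EReal.coe_lt_top (C * 27 / Real.log 2))
  filter_upwards [hω, eventually_ge_atTop 3] with T hT hT3
  refine EReal.coe_le_coe_iff.2 ?_
  have hT3' : (3 : ℝ) ≤ T := by exact_mod_cast hT3
  have hL : 1 ≤ Real.log T := by
    rw [Real.le_log_iff_exp_le (by linarith)]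
    linarith [Real.exp_one_lt_d9]
  have hL2 : Real.log ((T : ℝ) + 1) ≤ 2 * Real.log T := by
    have h1 := Real.log_le_log (by linarith) (show (T : ℝ) + 1 ≤ T ^ 2 by nlinarith)
    rwa [Real.log_pow] at h1
  have hL0 : 0 ≤ Real.log ((T : ℝ) + 1) := Real.log_nonneg (by linarith)
  have h2 : (0 : ℝ) < Real.log 2 := Real.log_pos one_lt_two
  have h4 : (DLA.rad G o (A T ω) : ℝ) * Real.log 2 ≤ C * 27 * Real.log T ^ 4 := by
    calc (DLA.rad G o (A T ω) : ℝ) * Real.log 2 ≤ C * (1 + Real.log (T + 1)) ^ 3 := hT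
      _ ≤ C * (3 * Real.log T) ^ 3 := by gcongr; linarith
      _ = C * 27 * Real.log T ^ 3 := by ring
      _ ≤ C * 27 * Real.log T ^ 4 := by gcongr; norm_num
  rw [zpow_neg, ← div_eq_inv_mul, div_le_div_iff₀ (by positivity) h2]
  exact_mod_cast h4
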